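/- **Setting.** A MAPF instance consists of a finite directed reflexive graph $G=(V,E)$, a finite set $A$ of agents, and start and goal vertices $\rho_s(a),\rho_g(a)$, $a\in A$. For $S\subseteq A$ and a state $x\colon A\to V$, a solution for $S$ from $x$ of length $M$ consists of walks $(v^a_0,\dots,v^a_M)$ in $G$, $a\in S$, with $v^a_0=x(a)$ and $v^a_M=\rho_g(a)$, that are conflict-free, i.e. for $a\ne b$ never $v^a_t=v^b_t$ (vertex conflict) and never $v^a_t=v^b_{t+1}$, $v^a_{t+1}=v^b_t$ (edge conflict). Let $p^a(v)=0$ if $v=\rho_g(a)$ and $p^a(v)=1$ otherwise, let $d$ be the directed shortest path distance ($\infty$ if there is no path), and $\gamma(v,a)=d(v,\rho_g(a))$. The sum of costs is $\mathrm{SOC}=\sum_a\sum_t p^a(v^a_t)$; a solution for $A$ from $\rho_s$ is SOC-optimal if its SOC is minimal among all such solutions of any length. The cost of a prefix of length $h$ is $\mathcal C_h=\sum_a\bigl(\sum_{t<h}p^a(v^a_t)+\gamma(v^a_h,a)\bigr)$. **DACCBS, without time limit.** A complete backup controller is a map that, for a set of agents and a state, returns a solution whenever one exists, and otherwise nothing;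 its rollout is trivial when all these agents are at their goals. The closed loop keeps the current state $x_t$ and a partition of $A$ into groups; each group has a certificate (a solution for the group from $x_t$), a budget (its cost), and the slackness recorded at its last factorization. At $t=0$ there is one group, $A$, with a backup rollout as certificate and any recorded slackness. While some agent is away from its goal, a control step does the following. 1. *Search, for each group $S$.* The nodes of the constraint tree carry a finite set of vertex constraints (agent $a$ must not be at $v$ at time $t$) and edge constraints ($a$ must not traverse $(u,w)$ between $t$ and $t+1$), and for each $a\in S$ a walk of length $H_{\max}$ from $x_t(a)$ to $\rho_g(a)$ that obeys them and has minimal individual cost $\mathcal C_{H_{\max}}$ among these. The queue starts with the node without constraints, and the running horizon is $h_r=1$. Repeatedly, a node of minimal cost $\mathcal C_{h_r}$ is taken from the queue. If its walks have a conflict within the times $0,\dots,h_r$, one such conflict is selected, and the two children, each forbidding the conflict to one of the two agents and replanning that agent, are inserted (a child, or the root, is omitted if no walk exists). If there is none, the prefix of length $h_r$ followed by a backup rollout from its end state is a candidate that replaces the certificate if its cost is strictly smaller than the budget (which is then set to that cost); if $h_r=H_{\max}$ the search stops and returns the walks of this node, otherwise $h_r$ is increased by one and the same node is examined again. The search also stops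 when the queue is empty. 2. *Factorization.* The slackness of a group is its budget minus $\sum_{a\in S}\gamma(x_t(a),a)$. If it is smaller than the recorded one by at least a threshold $\mathcal T$, the group is split into parts such that agents $a,b$ in different parts have disjoint regions, the region of $a$ being $\{v: d(x_t(a),v)+\gamma(v,a)-\gamma(x_t(a),a)\le\text{slackness}\}$. The parts inherit the certificate restricted to them, with its cost as budget and with their own slackness recorded. 3. *Execution.* All agents make the first move of their certificates; certificates are truncated by this move, and $\sum_{a\in S}p^a(x_t(a))$ is subtracted from the budget of each group $S$. **Lemma (SOC optimality of DACCBS).** Let $H_{\max}\ge1$ and suppose that some SOC-optimal solution has makespan at most $H_{\max}$. Then, for every complete backup controller, every threshold, and every choice of ties, conflicts, optimal individual walks and factorizations: (a) The search at $t=0$ stops after finitely many iterations (with a bound independent of the choices). It stops with a node that is conflict-free at $h_r=H_{\max}$, and the walks of that node form a conflict-free joint trajectory of length $H_{\max}$ from $\rho_s$ to $\rho_g$ that is SOC-optimal. The certificate at that moment is also SOC-optimal, and its budget equals its SOC. (b) The search of every group in every later control step also stops after finitely many iterations (with a bound independent of the choices made in it). (c) The closed loop can always be continued until all agents are at their goals,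 which happens after finitely many control steps (with a bound independent of the choices), and the executed joint trajectory is a conflict-free SOC-optimal solution. -/

import Mathlib

namespace MAPF

/-! ## Instances, trajectories, conflicts and costs -/

/-- A multi-agent path finding instance: a directed reflexive graph, with a start and a goal vertex
for every agent. -/
structure Instance (A V : Type*) where
  graph : Digraph V
  reflexive : ∀ v, graph.Adj v v
  start : A → V
  goal : A → V

/-- A joint trajectory: for every agent `a` the vertices `pos a 0, …, pos a len`.
(Values of `pos` beyond `len` carry no meaning.) -/
structure JointTraj (A V : Type*) where
  len : ℕ
  pos : A → ℕ → V

/-- Position of an agent at time `t`, after padding with waits at the terminal vertex. -/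
def JointTraj.loc {A V : Type*} (τ : JointTraj A V) (a : A) (t : ℕ) : V :=
  τ.pos a (min t τ.len)

/-- Remove the first step (padded, so that a trajectory of length `0` keeps waiting). -/
def JointTraj.tail {A V : Type*} (τ : JointTraj A V) : JointTraj A V where
  len := τ.len - 1
  pos := fun a t => τ.loc a (t + 1)

/-- The prefix of length `h` of the trajectories `w`, followed by the joint trajectory `σ`. -/
def concatTraj {A V : Type*} (w : A → ℕ → V) (h : ℕ) (σ : JointTraj A V) : JointTraj A V where
  len := h + σ.len
  pos := fun a t => if t ≤ h then w a t else σ.pos a (t - h)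

/-- Two trajectories occupy the same vertex at time `t ≤ h`. -/
def VertexConflict {V : Type*} (p q : ℕ → V) (h t : ℕ) : Prop :=
  t ≤ h ∧ p t = q t

/-- Two trajectories swap their vertices between the times `t` and `t + 1 ≤ h`. -/
def EdgeConflict {V : Type*} (p q : ℕ → V) (h t : ℕ) : Prop :=
  t + 1 ≤ h ∧ p t = q (t + 1) ∧ p (t + 1) = q t

/-- The trajectories of the agents in `S` have no conflict within the times `0, …, h`. -/
def ConflictFree {A V : Type*} (S : Finset A) (w : A → ℕ → V) (h : ℕ) : Prop :=
  ∀ i ∈ S, ∀ j ∈ S, i ≠ j →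
    ∀ t, ¬ VertexConflict (w i) (w j) h t ∧ ¬ EdgeConflict (w i) (w j) h t

/-- `τ` moves the agents of `S` without conflicts from the state `x` to their goals. -/
structure IsSolution {A V : Type*} (I : Instance A V) (S : Finset A) (x : A → V)
    (τ : JointTraj A V) : Prop where
  source : ∀ a ∈ S, τ.pos a 0 = x a
  moves : ∀ a ∈ S, ∀ t < τ.len, I.graph.Adj (τ.pos a t) (τ.pos a (t + 1))
  target : ∀ a ∈ S, τ.pos a τ.len = I.goal a
  conflictFree : ConflictFree S τ.pos τ.len

/-- Running cost: `1` away from the goal, `0` at the goal. -/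
def runningCost {A V : Type*} [DecidableEq V] (I : Instance A V) (a : A) (v : V) : ℕ :=
  if v = I.goal a then 0 else 1

/-- Sum of costs of a joint trajectory of the whole fleet. -/
def soc {A V : Type*} [Fintype A] [DecidableEq V] (I : Instance A V) (τ : JointTraj A V) : ℕ :=
  ∑ a, ∑ t ∈ Finset.range (τ.len + 1), runningCost I a (τ.pos a t)

/-- A solution of the one-shot problem whose sum of costs is minimal among all solutions,
of whatever length. -/
def IsSOCOptimal {A V : Type*} [Fintype A] [DecidableEq V] (I : Instance A V)
    (τ : JointTraj A V) : Prop :=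
  IsSolution I Finset.univ I.start τ ∧
    ∀ σ, IsSolution I Finset.univ I.start σ → soc I τ ≤ soc I σ

/-- There is a path with `k` edges from `u` to `v`. -/
def HasPath {V : Type*} (G : Digraph V) (u v : V) (k : ℕ) : Prop :=
  ∃ w : ℕ → V, w 0 = u ∧ w k = v ∧ ∀ t < k, G.Adj (w t) (w (t + 1))

/-- Length of a shortest directed path (`⊤` if there is none). -/
noncomputable def pathDist {V : Type*} (G : Digraph V) (u v : V) : ℕ∞ :=
  ⨅ (k : ℕ) (_ : HasPath G u v k), (k : ℕ∞)

/-- Terminal cost: the length of a shortest path from `v` to the goal of `a`. -/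
noncomputable def costToGo {A V : Type*} (I : Instance A V) (a : A) (v : V) : ℕ∞ :=
  pathDist I.graph v (I.goal a)

/-- Cost of the prefix of length `h` of a trajectory of `a`: running costs plus terminal cost. -/
noncomputable def trajCost {A V : Type*} [DecidableEq V] (I : Instance A V) (a : A)
    (p : ℕ → V) (h : ℕ) : ℕ∞ :=
  ∑ t ∈ Finset.range h, (runningCost I a (p t) : ℕ∞) + costToGo I a (p h)

/-- Cost of the prefixes of length `h` of the trajectories of the agents in `S`. -/
noncomputable def jointCost {A V : Type*} [DecidableEq V] (I : Instance A V) (S : Finset A)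
    (w : A → ℕ → V) (h : ℕ) : ℕ∞ :=
  ∑ a ∈ S, trajCost I a (w a) h

/-! ## Backup controller -/

/-- A complete backup controller: for a set of agents and a current state it returns a
conflict-free joint trajectory of these agents to their goals whenever there is one. -/
structure BackupController {A V : Type*} (I : Instance A V) where
  plan : Finset A → (A → V) → Option (JointTraj A V)
  sound : ∀ S x τ, plan S x = some τ → IsSolution I S x τ
  complete : ∀ S x, (∃ τ, IsSolution I S x τ) → ∃ τ, plan S x = some τ

/-- Rollout of the backup controller from the state `x`.
The evolution has already ended if all the agents are at their goals. -/
noncomputable def rollout {A V : Type*} {I : Instance A V} (π : BackupController I)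
    (S : Finset A) (x : A → V) : Option (JointTraj A V) :=
  open Classical in
  if ∀ a ∈ S, x a = I.goal a then some ⟨0, fun a _ => x a⟩ else π.plan S x

/-! ## Constraint tree -/

/-- Vertex and edge constraints. `vertex a t v` forbids `a` to be at `v` at time `t`, and
`edge a t u v` forbids `a` to traverse the edge from `u` to `v` between `t` and `t + 1`. -/
inductive Constraint (A V : Type*) where
  | vertex (a : A) (t : ℕ) (v : V)
  | edge (a : A) (t : ℕ) (u v : V)
  deriving DecidableEq

/-- The trajectory `p` of agent `a` obeys the constraint (which may concern another agent). -/
def Constraint.Obeyed {A V : Type*} (a : A) (p : ℕ → V) : Constraint A V → Prop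
  | .vertex b t v => b = a → p t ≠ v
  | .edge b t u v => b = a → ¬ (p t = u ∧ p (t + 1) = v)

/-- `p` is a trajectory of length `H` of agent `a` from its position in the state `x` to its goal
that satisfies the constraint set `C`. -/
structure IsFeasible {A V : Type*} (I : Instance A V) (H : ℕ) (x : A → V)
    (C : Finset (Constraint A V)) (a : A) (p : ℕ → V) : Prop where
  source : p 0 = x a
  moves : ∀ t < H, I.graph.Adj (p t) (p (t + 1))
  target : p H = I.goal a
  obeys : ∀ c ∈ C, c.Obeyed a p

/-- The outcome of the low-level planner: an individually optimal trajectory of length `H`. -/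
def IsBestResponse {A V : Type*} [DecidableEq V] (I : Instance A V) (H : ℕ) (x : A → V)
    (C : Finset (Constraint A V)) (a : A) (p : ℕ → V) : Prop :=
  IsFeasible I H x C a p ∧ ∀ q, IsFeasible I H x C a q → trajCost I a p H ≤ trajCost I a q H

/-- A node of the constraint tree: constraints and trajectories. Its cost is `Node.cost`. -/
structure Node (A V : Type*) where
  constraints : Finset (Constraint A V)
  traj : A → ℕ → V

/-- Node cost for the running horizon `h`: the cost of the active prefix. -/
noncomputable def Node.cost {A V : Type*} [DecidableEq V] (I : Instance A V) (S : Finset A)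
    (h : ℕ) (n : Node A V) : ℕ∞ :=
  jointCost I S n.traj h

/-- `Q` is the initial queue: the root node, without constraints and with individually optimal
trajectories. (There is no root if some agent cannot reach its goal within `H` steps.) -/
def RootGen {A V : Type*} [DecidableEq V] (I : Instance A V) (S : Finset A) (H : ℕ)
    (x : A → V) (Q : Multiset (Node A V)) : Prop :=
  (∃ n : Node A V, n.constraints = ∅ ∧ (∀ a ∈ S, IsBestResponse I H x ∅ a (n.traj a)) ∧ Q = {n}) ∨
  ((∃ a ∈ S, ¬ ∃ p, IsFeasible I H x ∅ a p) ∧ Q = 0)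

/-- `Q` holds the child of `n` obtained by adding the constraint `c` and replanning agent `a`.
(There is no child if agent `a` has no feasible trajectory left.) -/
def ChildGen {A V : Type*} [DecidableEq A] [DecidableEq V] (I : Instance A V) (H : ℕ)
    (x : A → V) (n : Node A V) (a : A) (c : Constraint A V) (Q : Multiset (Node A V)) : Prop :=
  (∃ p, IsBestResponse I H x (insert c n.constraints) a p ∧
    Q = {⟨insert c n.constraints, Function.update n.traj a p⟩}) ∨
  ((¬ ∃ p, IsFeasible I H x (insert c n.constraints) a p) ∧ Q = 0)

/-! ## The search of one control step, for one group of agents, without time limit -/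

/-- Control location of the search: about to take a node from the queue, working on the node `n`,
stopped with the node `n`, or stopped with an empty queue. -/
inductive Phase (A V : Type*) where
  | selecting
  | examining (n : Node A V)
  | found (n : Node A V)
  | exhausted

/-- State of the search: the queue, the running horizon, the control location, and the incumbent
certificate with its budget. -/
structure SearchState (A V : Type*) where
  queue : Multiset (Node A V)
  horizon : ℕ
  phase : Phase A V
  cert : JointTraj A V
  budget : ℕ∞

/-- The search has stopped. -/
def SearchState.Halted {A V : Type*} (s : SearchState A V) : Prop :=
  (∃ n, s.phase = .found n) ∨ s.phase = .exhausted

/-- Within-timestep update: the conflict-free active prefix of `n` is completed by a backup rollout,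
and the result becomes the new certificate if it is strictly cheaper than the budget. -/
noncomputable def SearchState.updateCert {A V : Type*} [DecidableEq V] {I : Instance A V}
    (π : BackupController I) (S : Finset A) (n : Node A V) (s : SearchState A V) :
    SearchState A V :=
  match rollout π S (fun a => n.traj a s.horizon) with
  | none => s
  | some σ =>
    let cand := concatTraj n.traj s.horizon σ
    if jointCost I S cand.pos cand.len < s.budget then
      { s with cert := cand, budget := jointCost I S cand.pos cand.len }
    else s

/-- Start of the search from the state `x` with the incumbent certificate `cert`. -/
def SearchStart {A V : Type*} [DecidableEq V] (I : Instance A V) (S : Finset A) (H : ℕ)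
    (x : A → V) (cert : JointTraj A V) (budget : ℕ∞) (s : SearchState A V) : Prop :=
  RootGen I S H x s.queue ∧ s.horizon = 1 ∧ s.phase = .selecting ∧
    s.cert = cert ∧ s.budget = budget

/-- One step of the search. Ties in the queue, the conflict to be resolved and the optimal
individual trajectories may be chosen in any way. -/
inductive SearchStep {A V : Type*} [DecidableEq A] [DecidableEq V] (I : Instance A V)
    (π : BackupController I) (S : Finset A) (H : ℕ) (x : A → V) :
    SearchState A V → SearchState A V → Prop
  /-- Take a cheapest node, for the current running horizon, from the queue. -/
  | dequeue (s : SearchState A V) (n : Node A V) (Q : Multiset (Node A V))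
      (hs : s.phase = .selecting) (hQ : s.queue = n ::ₘ Q)
      (hmin : ∀ m ∈ Q, n.cost I S s.horizon ≤ m.cost I S s.horizon) :
      SearchStep I π S H x s { s with queue := Q, phase := .examining n }
  /-- The queue is empty. -/
  | exhaust (s : SearchState A V) (hs : s.phase = .selecting) (hQ : s.queue = 0) :
      SearchStep I π S H x s { s with phase := .exhausted }
  /-- Branch on a vertex conflict within the active prefix. -/
  | branchVertex (s : SearchState A V) (n : Node A V) (hs : s.phase = .examining n)
      (i j : A) (hi : i ∈ S) (hj : j ∈ S) (hij : i ≠ j) (t : ℕ)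
      (hc : VertexConflict (n.traj i) (n.traj j) s.horizon t)
      (Qi Qj : Multiset (Node A V))
      (hQi : ChildGen I H x n i (.vertex i t (n.traj i t)) Qi)
      (hQj : ChildGen I H x n j (.vertex j t (n.traj j t)) Qj) :
      SearchStep I π S H x s { s with queue := s.queue + Qi + Qj, phase := .selecting }
  /-- Branch on an edge conflict within the active prefix. -/
  | branchEdge (s : SearchState A V) (n : Node A V) (hs : s.phase = .examining n)
      (i j : A) (hi : i ∈ S) (hj : j ∈ S) (hij : i ≠ j) (t : ℕ)
      (hc : EdgeConflict (n.traj i) (n.traj j) s.horizon t)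
      (Qi Qj : Multiset (Node A V))
      (hQi : ChildGen I H x n i (.edge i t (n.traj i t) (n.traj i (t + 1))) Qi)
      (hQj : ChildGen I H x n j (.edge j t (n.traj j t) (n.traj j (t + 1))) Qj) :
      SearchStep I π S H x s { s with queue := s.queue + Qi + Qj, phase := .selecting }
  /-- The active prefix is conflict-free: update the certificate and extend the horizon. -/
  | extend (s : SearchState A V) (n : Node A V) (hs : s.phase = .examining n)
      (hfree : ConflictFree S n.traj s.horizon) (hh : s.horizon < H) :
      SearchStep I π S H x s { s.updateCert π S n with horizon := s.horizon + 1 }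
  /-- The active prefix is conflict-free up to the maximal horizon: update the certificate, stop. -/
  | finish (s : SearchState A V) (n : Node A V) (hs : s.phase = .examining n)
      (hfree : ConflictFree S n.traj s.horizon) (hh : s.horizon = H) :
      SearchStep I π S H x s { s.updateCert π S n with phase := .found n }

/-! ## Budget-limited factorization -/

/-- A group of agents with its certificate, its budget, and its slackness at the last
factorization. -/
structure Group (A V : Type*) where
  agents : Finset A
  cert : JointTraj A V
  budget : ℕ∞
  lastSlack : ℕ∞

/-- Slackness of a group under a budget: the budget minus the sum of the shortest path lengths. -/
noncomputable def slackness {A V : Type*} (I : Instance A V) (x : A → V) (S : Finset A)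
    (budget : ℕ∞) : ℕ∞ :=
  budget - ∑ a ∈ S, costToGo I a (x a)

/-- Budget-limited reachable region of agent `a` in the state `x` for the given slackness. -/
def region {A V : Type*} (I : Instance A V) (x : A → V) (slack : ℕ∞) (a : A) : Set V :=
  {v | pathDist I.graph (x a) v + costToGo I a v - costToGo I a (x a) ≤ slack}

/-- The list `gs` is a budget-limited factorization of the group `g` in the state `x`: a partition
of its agents such that agents in different parts have disjoint reachable regions.
The parts inherit the certificate. -/
structure IsFactorization {A V : Type*} [DecidableEq V] (I : Instance A V)
    (x : A → V) (g : Group A V) (gs : List (Group A V)) : Prop where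
  cover : ∀ a, a ∈ g.agents ↔ ∃ k ∈ gs, a ∈ k.agents
  disjoint : gs.Pairwise fun k l => Disjoint k.agents l.agents
  separated : gs.Pairwise fun k l => ∀ a ∈ k.agents, ∀ b ∈ l.agents,
    Disjoint (region I x (slackness I x g.agents g.budget) a)
      (region I x (slackness I x g.agents g.budget) b)
  cert : ∀ k ∈ gs, k.cert = g.cert
  budget : ∀ k ∈ gs, k.budget = jointCost I k.agents g.cert.pos g.cert.len
  lastSlack : ∀ k ∈ gs, k.lastSlack = slackness I x k.agents k.budget

/-- The group is factorized if its slackness has dropped by at least the threshold `T`. -/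
def Refactor {A V : Type*} [DecidableEq V] (I : Instance A V) (T : ℕ∞) (x : A → V)
    (g : Group A V) (gs : List (Group A V)) : Prop :=
  (T + slackness I x g.agents g.budget ≤ g.lastSlack ∧ IsFactorization I x g gs) ∨
  (¬ T + slackness I x g.agents g.budget ≤ g.lastSlack ∧ gs = [g])

/-! ## The closed loop -/

/-- State of the closed loop at the beginning of the planning of a control step: the positions of
the agents, and the groups with the inherited certificates and budgets. -/
structure SystemState (A V : Type*) where
  pos : A → V
  groups : List (Group A V)

/-- All agents have reached their goals. -/
def SystemState.Terminal {A V : Type*} (I : Instance A V) (σ : SystemState A V) : Prop :=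
  ∀ a, σ.pos a = I.goal a

/-- Initially the fleet is one group, whose certificate is a backup rollout. -/
def SystemStart {A V : Type*} [Fintype A] [DecidableEq V] (I : Instance A V)
    (π : BackupController I) (S₀ : ℕ∞) (σ : SystemState A V) : Prop :=
  σ.pos = I.start ∧ ∃ τ, rollout π Finset.univ I.start = some τ ∧
    σ.groups = [⟨Finset.univ, τ, jointCost I Finset.univ τ.pos τ.len, S₀⟩]

/-- Planning for the group `g` in the state `x`: a complete run of the search, followed by the
factorization of the group into the groups `gs`. -/
def GroupPlan {A V : Type*} [DecidableEq A] [DecidableEq V] (I : Instance A V)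
    (π : BackupController I) (H : ℕ) (T : ℕ∞) (x : A → V)
    (g : Group A V) (gs : List (Group A V)) : Prop :=
  ∃ s₀ s, SearchStart I g.agents H x g.cert g.budget s₀ ∧
    Relation.ReflTransGen (SearchStep I π g.agents H x) s₀ s ∧ s.Halted ∧
    Refactor I T x { g with cert := s.cert, budget := s.budget } gs

/-- Across-timesteps update: truncate the certificate and pay the running costs. -/
def Group.inherit {A V : Type*} [DecidableEq V] (I : Instance A V) (x : A → V)
    (g : Group A V) : Group A V :=
  { g with
    cert := g.cert.tail
    budget := g.budget - ∑ a ∈ g.agents, (runningCost I a (x a) : ℕ∞) }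

/-- One control step: plan for every group, execute the first step of the certificates, and
inherit the truncated certificates. -/
def ControlStep {A V : Type*} [DecidableEq A] [DecidableEq V] (I : Instance A V)
    (π : BackupController I) (H : ℕ) (T : ℕ∞) (σ σ' : SystemState A V) : Prop :=
  ¬ σ.Terminal I ∧ ∃ gss : List (List (Group A V)),
    List.Forall₂ (GroupPlan I π H T σ.pos) σ.groups gss ∧
    (∀ g ∈ gss.flatten, ∀ a ∈ g.agents, σ'.pos a = g.cert.loc a 1) ∧
    σ'.groups = gss.flatten.map (Group.inherit I σ.pos)

/-! ## Termination -/

/-- Every run of the transition relation `step` from an initial state is finite, with a common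
bound on the number of steps, and a run can be continued until it reaches a final state. -/
def Terminates {α : Type*} (init : α → Prop) (step : α → α → Prop) (final : α → Prop) : Prop :=
  (∃ s, init s) ∧
  (∃ N : ℕ, ∀ (k : ℕ) (f : ℕ → α), init (f 0) → (∀ i < k, step (f i) (f (i + 1))) → k ≤ N) ∧
  (∀ s₀ s, init s₀ → Relation.ReflTransGen step s₀ s → ¬ final s → ∃ s', step s s')

end MAPF

namespace MAPF

/-! ## Shortest paths -/

section Paths

variable {V : Type*} {G : Digraph V} {u v w : V}

/-! The proof combines best-first optimality of conflict-based search with an exchange argument for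
the factorized groups.

Search. Every constraint of an open node concerns times within the running horizon `h`. An
individually optimal walk follows a shortest path after its last constraint, so its prefix cost at
`h` already equals its cost at `H` (`IsBestResponse.trajCost_eq`). The growing horizon therefore
does not disturb the best-first order. Branching always keeps an open node whose constraints a given
solution `q` satisfies, and such a node costs at most as much as `q`. So no examined node is dearer
than an optimal solution, and the final node, being conflict-free, is optimal (`search_found`). At
`H` its rollout is trivial, which brings the budget down to the optimum as well (`initial_search`).
Termination holds since only finitely many constraints concern times up to `H` and every child has
one more than its parent (`SearchInv.potential_lt`).

Closed loop. Let `τ` be the optimal certificate of the first search. A later search replaces a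
certificate only by a strictly cheaper one, so it is enough that no group `S` has a solution cheaper
than its remainder of `τ` (`IsSOCOptimal.remCost_le`). Given a cheaper one, splice it into `τ`. Any
agent outside `S` was separated from `S` at some earlier time within a common group; the spliced
walks stay strictly below the budget of that group, hence inside the regions of that time
(`mem_region`). These are disjoint, so there are no new conflicts, and the spliced solution beats
`τ`, a contradiction. Thus the loop follows `τ`, and since every nonterminal state pays at least one
unit, it ends within the optimal sum of costs. -/

theorem pathDist_le {k : ℕ} (h : HasPath G u v k) : pathDist G u v ≤ k :=
  iInf₂_le k h

theorem exists_hasPath_eq_pathDist (h : pathDist G u v ≠ ⊤) :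
    ∃ k : ℕ, HasPath G u v k ∧ pathDist G u v = k := by
  classical
  have hex : ∃ k, HasPath G u v k := by
    by_contra! hno
    exact h (by simp [pathDist, hno])
  exact ⟨Nat.find hex, Nat.find_spec hex, le_antisymm (pathDist_le (Nat.find_spec hex))
    (le_iInf₂ fun k hk => by exact_mod_cast Nat.find_min' hex hk)⟩

theorem pathDist_self : pathDist G u u = 0 :=
  le_antisymm (pathDist_le (k := 0) ⟨fun _ => u, rfl, rfl, by simp⟩) bot_le

theorem HasPath.snoc {k : ℕ} (h : HasPath G u v k) (hvw : G.Adj v w) :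
    HasPath G u w (k + 1) := by
  obtain ⟨p, h0, hk, hm⟩ := h
  refine ⟨fun s => if s ≤ k then p s else w, by simpa using h0, by simp, fun t ht => ?_⟩
  rcases Nat.lt_succ_iff_lt_or_eq.1 ht with h | rfl
  · simpa [h.le, Nat.succ_le_of_lt h] using hm t h
  · simpa [hk] using hvw

theorem HasPath.cons {k : ℕ} (huv : G.Adj u v) (h : HasPath G v w k) :
    HasPath G u w (k + 1) := by
  obtain ⟨p, h0, hk, hm⟩ := h
  refine ⟨fun s => if s = 0 then u else p (s - 1), by simp, by simpa using hk, fun t ht => ?_⟩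
  rcases t with _ | t
  · simpa [h0] using huv
  · simpa using hm t (by omega)

theorem pathDist_snoc_le (hvw : G.Adj v w) : pathDist G u w ≤ pathDist G u v + 1 := by
  by_cases h : pathDist G u v = ⊤
  · simp [h]
  · obtain ⟨k, hk, e⟩ := exists_hasPath_eq_pathDist h
    rw [e]
    exact_mod_cast pathDist_le (hk.snoc hvw)

theorem pathDist_cons_le (huv : G.Adj u v) : pathDist G u w ≤ 1 + pathDist G v w := by
  by_cases h : pathDist G v w = ⊤
  · simp [h]
  · obtain ⟨k, hk, e⟩ := exists_hasPath_eq_pathDist h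
    rw [e, add_comm]
    exact_mod_cast pathDist_le (hk.cons huv)

end Paths

/-! ## Splicing of walks -/

section Splice

variable {V : Type*} {p q : ℕ → V}

/-- The first `t` vertices of `p`, followed by `q`. -/
def splice (p : ℕ → V) (t : ℕ) (q : ℕ → V) (s : ℕ) : V :=
  if s < t then p s else q (s - t)

theorem splice_of_ge {t s : ℕ} (h : t ≤ s) : splice p t q s = q (s - t) := if_neg (by omega)

theorem splice_of_le {t s : ℕ} (hq : q 0 = p t) (h : s ≤ t) : splice p t q s = p s := by
  rcases h.lt_or_eq with h | rfl
  · exact if_pos h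
  · rw [splice_of_ge le_rfl, Nat.sub_self, hq]

theorem splice_adj {t : ℕ} (hq : q 0 = p t) {G : Digraph V} {s : ℕ}
    (hp : s < t → G.Adj (p s) (p (s + 1))) (h : t ≤ s → G.Adj (q (s - t)) (q (s - t + 1))) :
    G.Adj (splice p t q s) (splice p t q (s + 1)) := by
  by_cases hs : s < t
  · rw [splice_of_le hq hs.le, splice_of_le hq hs]; exact hp hs
  · rw [splice_of_ge (by omega), splice_of_ge (by omega), Nat.sub_add_comm (by omega)]
    exact h (by omega)

end Splice

/-! ## Costs of walks -/

section Costs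

@[simp] theorem costToGo_goal {A V : Type*} {I : Instance A V} {a : A} :
    costToGo I a (I.goal a) = 0 := pathDist_self

variable {A V : Type*} [DecidableEq V] {I : Instance A V} {a : A} {p q : ℕ → V}

/-- Running costs of the first `n` vertices of `p`. -/
def walkCost (I : Instance A V) (a : A) (p : ℕ → V) (n : ℕ) : ℕ :=
  ∑ t ∈ Finset.range n, runningCost I a (p t)

@[simp] theorem runningCost_goal : runningCost I a (I.goal a) = 0 := by simp [runningCost]

theorem runningCost_le_one (v : V) : runningCost I a v ≤ 1 := by
  unfold runningCost; split <;> simp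

@[simp] theorem walkCost_zero : walkCost I a p 0 = 0 := rfl

theorem walkCost_succ (n : ℕ) :
    walkCost I a p (n + 1) = walkCost I a p n + runningCost I a (p n) :=
  Finset.sum_range_succ _ _

theorem walkCost_add (m n : ℕ) :
    walkCost I a p (m + n) = walkCost I a p m + walkCost I a (fun s => p (m + s)) n :=
  Finset.sum_range_add _ _ _

theorem walkCost_congr {n : ℕ} (h : ∀ s < n, p s = q s) : walkCost I a p n = walkCost I a q n :=
  Finset.sum_congr rfl fun s hs => by rw [h s (Finset.mem_range.1 hs)]

theorem walkCost_of_goal {m n : ℕ} (hmn : m ≤ n) (h : ∀ s, m ≤ s → p s = I.goal a) :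
    walkCost I a p n = walkCost I a p m := by
  obtain ⟨k, rfl⟩ := Nat.exists_eq_add_of_le hmn
  rw [walkCost_add, Nat.add_eq_left]
  exact Finset.sum_eq_zero fun s _ => by
    dsimp only
    rw [h _ (by omega), runningCost_goal]

theorem trajCost_eq (h : ℕ) :
    trajCost I a p h = (walkCost I a p h : ℕ∞) + costToGo I a (p h) := by
  simp [trajCost, walkCost]

theorem trajCost_of_goal {h : ℕ} (hp : p h = I.goal a) :
    trajCost I a p h = (walkCost I a p h : ℕ∞) := by
  simp [trajCost_eq, hp]

/-- The distance to the goal drops by at most one per move. A move out of the goal is free, but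
there the left side is `0`. -/
theorem costToGo_le_of_adj {u v : V} (huv : I.graph.Adj u v) :
    costToGo I a u ≤ (runningCost I a u : ℕ∞) + costToGo I a v := by
  by_cases h : u = I.goal a
  · simp [h]
  · simpa [runningCost, h, costToGo] using pathDist_cons_le huv

theorem trajCost_mono {m n : ℕ} (hmn : m ≤ n)
    (hp : ∀ t < n, I.graph.Adj (p t) (p (t + 1))) : trajCost I a p m ≤ trajCost I a p n := by
  induction n, hmn using Nat.le_induction with
  | base => rfl
  | succ n hmn ih =>
    refine (ih fun t ht => hp t (by omega)).trans ?_
    rw [trajCost_eq, trajCost_eq, walkCost_succ, Nat.cast_add, add_assoc]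
    gcongr
    exact costToGo_le_of_adj (hp n (by omega))

theorem costToGo_le_walkCost {n : ℕ} (hp : ∀ t < n, I.graph.Adj (p t) (p (t + 1)))
    (hn : p n = I.goal a) : costToGo I a (p 0) ≤ walkCost I a p n := by
  rw [← trajCost_of_goal hn]
  simpa [trajCost_eq] using trajCost_mono (I := I) (a := a) (Nat.zero_le n) hp

/-- Leaving the goal is free, hence the additional `1`. -/
theorem pathDist_le_walkCost_add_one {n : ℕ} (hp : ∀ t < n, I.graph.Adj (p t) (p (t + 1))) :
    pathDist I.graph (p 0) (p n) ≤ walkCost I a p n + 1 := by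
  induction n with
  | zero => simp [pathDist_self]
  | succ n ih =>
    have hp' : ∀ t < n, I.graph.Adj (p t) (p (t + 1)) := fun t ht => hp t (by omega)
    refine (pathDist_snoc_le (hp n (by omega))).trans ?_
    gcongr
    rw [walkCost_succ]
    -- The free move out of the goal does not accumulate: a walk that is at its goal at time `n` has
    -- already paid the full distance, so the induction restarts without the extra `1`.
    by_cases h : p n = I.goal a
    · have := costToGo_le_walkCost hp' h
      rw [costToGo] at this
      simpa [h] using this
    · simpa [runningCost, h] using ih hp'

theorem pathDist_add_costToGo_le {s n : ℕ} (hs : s ≤ n)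
    (hp : ∀ t < n, I.graph.Adj (p t) (p (t + 1))) (hn : p n = I.goal a) :
    pathDist I.graph (p 0) (p s) + costToGo I a (p s) ≤ walkCost I a p n + 1 := by
  calc _ ≤ (walkCost I a p s + 1) + costToGo I a (p s) := by
        gcongr
        exact pathDist_le_walkCost_add_one fun t ht => hp t (by omega)
    _ = trajCost I a p s + 1 := by rw [trajCost_eq]; ring
    _ ≤ trajCost I a p n + 1 := by gcongr; exact trajCost_mono hs hp
    _ = _ := by rw [trajCost_of_goal hn]

/-- A shortest path to the goal, followed by waits. -/
theorem exists_shortest_walk {v : V} (hv : costToGo I a v ≠ ⊤) :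
    ∃ q : ℕ → V, q 0 = v ∧ (∀ t, I.graph.Adj (q t) (q (t + 1))) ∧
      (∀ t : ℕ, costToGo I a v ≤ t → q t = I.goal a) ∧
      ∀ n, (walkCost I a q n : ℕ∞) ≤ costToGo I a v := by
  obtain ⟨m, ⟨w, h0, hm, hw⟩, e⟩ := exists_hasPath_eq_pathDist hv
  rw [costToGo, e]
  have hgoal : ∀ t, m ≤ t → w (min t m) = I.goal a := fun t ht => by rw [min_eq_right ht, hm]
  refine ⟨fun t => w (min t m), by simpa using h0, fun t => ?_,
    fun t ht => hgoal t (by exact_mod_cast ht), fun n => ?_⟩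
  · by_cases h : t < m
    · simpa [h.le, Nat.succ_le_of_lt h] using hw t h
    · simpa [show min t m = m by omega, show min (t + 1) m = m by omega] using I.reflexive _
  · have hmin : walkCost I a (fun t => w (min t m)) n ≤ min n m := by
      induction n with
      | zero => simp
      | succ n ih =>
        rw [walkCost_succ]
        by_cases h : n < m
        · have := runningCost_le_one (I := I) (a := a) (w (min n m))
          omega
        · rw [hgoal n (by omega), runningCost_goal]
          omega
    exact_mod_cast hmin.trans (min_le_right _ _)

theorem walkCost_splice (t n : ℕ) :
    walkCost I a (splice p t q) (t + n) = walkCost I a p t + walkCost I a q n := by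
  rw [walkCost_add]
  congr 1
  · exact walkCost_congr fun s hs => if_pos hs
  · exact walkCost_congr fun s _ => by rw [splice_of_ge (by omega), Nat.add_sub_cancel_left]

end Costs

/-! ## Joint trajectories -/

section Trajectories

variable {A V : Type*} {I : Instance A V} {S : Finset A} {x : A → V} {τ : JointTraj A V}

theorem JointTraj.loc_of_le {a : A} {t : ℕ} (h : t ≤ τ.len) : τ.loc a t = τ.pos a t := by
  rw [JointTraj.loc, min_eq_left h]

theorem JointTraj.loc_of_ge {a : A} {t : ℕ} (h : τ.len ≤ t) : τ.loc a t = τ.pos a τ.len := by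
  rw [JointTraj.loc, min_eq_right h]

theorem JointTraj.len_tail_iterate (t : ℕ) : (JointTraj.tail^[t] τ).len = τ.len - t := by
  induction t with
  | zero => rfl
  | succ t ih => rw [Function.iterate_succ_apply', JointTraj.tail, ih, Nat.sub_sub]

theorem JointTraj.loc_tail (a : A) (s : ℕ) : τ.tail.loc a s = τ.loc a (s + 1) := by
  simp only [JointTraj.loc, JointTraj.tail]
  congr 1
  omega

theorem JointTraj.loc_tail_iterate (t : ℕ) (a : A) (s : ℕ) :
    (JointTraj.tail^[t] τ).loc a s = τ.loc a (t + s) := by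
  induction t generalizing s with
  | zero => simp
  | succ t ih =>
    rw [Function.iterate_succ_apply', JointTraj.loc_tail, ih]
    congr 1
    omega

theorem ConflictFree.mono {w : A → ℕ → V} {h k : ℕ} (hw : ConflictFree S w k) (hhk : h ≤ k) :
    ConflictFree S w h := fun i hi j hj hij t =>
  ⟨fun hc => (hw i hi j hj hij t).1 ⟨hc.1.trans hhk, hc.2⟩,
    fun hc => (hw i hi j hj hij t).2 ⟨hc.1.trans hhk, hc.2⟩⟩

theorem IsSolution.loc_zero (hτ : IsSolution I S x τ) {a : A} (ha : a ∈ S) :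
    τ.loc a 0 = x a := by
  rw [JointTraj.loc_of_le (Nat.zero_le _), hτ.source a ha]

theorem IsSolution.loc_goal (hτ : IsSolution I S x τ) {a : A} (ha : a ∈ S) {t : ℕ}
    (ht : τ.len ≤ t) : τ.loc a t = I.goal a := by
  rw [JointTraj.loc_of_ge ht, hτ.target a ha]

theorem IsSolution.loc_adj (hτ : IsSolution I S x τ) {a : A} (ha : a ∈ S) (t : ℕ) :
    I.graph.Adj (τ.loc a t) (τ.loc a (t + 1)) := by
  by_cases h : t < τ.len
  · rw [JointTraj.loc_of_le h.le, JointTraj.loc_of_le h]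
    exact hτ.moves a ha t h
  · rw [JointTraj.loc_of_ge (by omega), JointTraj.loc_of_ge (by omega)]
    exact I.reflexive _

theorem IsSolution.loc_ne (hτ : IsSolution I S x τ) {a b : A} (ha : a ∈ S) (hb : b ∈ S)
    (hab : a ≠ b) (t : ℕ) : τ.loc a t ≠ τ.loc b t := fun h =>
  (hτ.conflictFree a ha b hb hab (min t τ.len)).1 ⟨min_le_right _ _, h⟩

theorem IsSolution.loc_not_swap (hτ : IsSolution I S x τ) {a b : A} (ha : a ∈ S) (hb : b ∈ S)
    (hab : a ≠ b) (t : ℕ) :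
    ¬ (τ.loc a t = τ.loc b (t + 1) ∧ τ.loc a (t + 1) = τ.loc b t) := by
  rintro ⟨h1, h2⟩
  by_cases h : t < τ.len
  · rw [JointTraj.loc_of_le h.le, JointTraj.loc_of_le h] at h1 h2
    exact (hτ.conflictFree a ha b hb hab t).2 ⟨h, h1, h2⟩
  · refine hτ.loc_ne ha hb hab t ?_
    rw [h1, JointTraj.loc_of_ge (by omega), JointTraj.loc_of_ge (by omega)]

theorem IsSolution.conflictFree_loc (hτ : IsSolution I S x τ) (h : ℕ) :
    ConflictFree S τ.loc h := fun _ hi _ hj hij t =>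
  ⟨fun hc => hτ.loc_ne hi hj hij t hc.2, fun hc => hτ.loc_not_swap hi hj hij t hc.2⟩

theorem isSolution_concatTraj {w : A → ℕ → V} {h : ℕ} {σ : JointTraj A V}
    (h0 : ∀ a ∈ S, w a 0 = x a) (hm : ∀ a ∈ S, ∀ t < h, I.graph.Adj (w a t) (w a (t + 1)))
    (hw : ConflictFree S w h) (hσ : IsSolution I S (fun a => w a h) σ) :
    IsSolution I S x (concatTraj w h σ) := by
  have hle : ∀ a t, t ≤ h → (concatTraj w h σ).pos a t = w a t := fun a t ht => if_pos ht
  have hge : ∀ a ∈ S, ∀ t, h ≤ t → (concatTraj w h σ).pos a t = σ.pos a (t - h) := by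
    intro a ha t ht
    rcases ht.eq_or_lt with rfl | ht
    · rw [hle a _ le_rfl, Nat.sub_self, hσ.source a ha]
    · exact if_neg (by omega)
  have hlen : (concatTraj w h σ).len = h + σ.len := rfl
  refine ⟨fun a ha => by rw [hle a 0 (Nat.zero_le _), h0 a ha], fun a ha t ht => ?_,
    fun a ha => ?_, fun i hi j hj hij t => ⟨fun hc => ?_, fun hc => ?_⟩⟩
  · by_cases hth : t < h
    · rw [hle a t hth.le, hle a _ hth]; exact hm a ha t hth
    · rw [hge a ha t (by omega), hge a ha _ (by omega), Nat.sub_add_comm (by omega)]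
      exact hσ.moves a ha _ (by omega)
  · rw [hge a ha _ (by omega), hlen, Nat.add_sub_cancel_left, hσ.target a ha]
  · obtain ⟨h1, h2⟩ := hc
    by_cases hth : t ≤ h
    · rw [hle i t hth, hle j t hth] at h2
      exact (hw i hi j hj hij t).1 ⟨hth, h2⟩
    · rw [hge i hi t (by omega), hge j hj t (by omega)] at h2
      exact (hσ.conflictFree i hi j hj hij (t - h)).1 ⟨by omega, h2⟩
  · obtain ⟨h1, h2, h3⟩ := hc
    by_cases hth : t < h
    · rw [hle i t hth.le, hle j _ hth] at h2
      rw [hle i _ hth, hle j t hth.le] at h3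
      exact (hw i hi j hj hij t).2 ⟨hth, h2, h3⟩
    · rw [hge i hi t (by omega), hge j hj _ (by omega), Nat.sub_add_comm (by omega)] at h2
      rw [hge i hi _ (by omega), hge j hj t (by omega), Nat.sub_add_comm (by omega)] at h3
      exact (hσ.conflictFree i hi j hj hij (t - h)).2 ⟨by omega, h2, h3⟩

variable [DecidableEq V]

theorem jointCost_congr {w w' : A → ℕ → V} {h : ℕ} (hw : ∀ a ∈ S, ∀ t ≤ h, w a t = w' a t) :
    jointCost I S w h = jointCost I S w' h :=
  Finset.sum_congr rfl fun a ha => by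
    rw [trajCost_eq, trajCost_eq, hw a ha h le_rfl, walkCost_congr fun s hs => hw a ha s hs.le]

theorem jointCost_of_goal {w : A → ℕ → V} {h : ℕ} (hw : ∀ a ∈ S, w a h = I.goal a) :
    jointCost I S w h = ((∑ a ∈ S, walkCost I a (w a) h : ℕ) : ℕ∞) := by
  rw [Nat.cast_sum]
  exact Finset.sum_congr rfl fun a ha => trajCost_of_goal (hw a ha)

/-- Waiting at the goal is free, so solutions of different lengths can be compared over a common
length `n`. -/
theorem IsSolution.jointCost_eq (hτ : IsSolution I S x τ) {n : ℕ} (hn : τ.len ≤ n) :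
    jointCost I S τ.pos τ.len = ((∑ a ∈ S, walkCost I a (τ.loc a) n : ℕ) : ℕ∞) := by
  rw [jointCost_of_goal hτ.target]
  congr 1
  refine Finset.sum_congr rfl fun a ha => ?_
  rw [walkCost_of_goal hn fun s => hτ.loc_goal ha]
  exact walkCost_congr fun s hs => (JointTraj.loc_of_le hs.le).symm

theorem soc_eq_sum_walkCost [Fintype A] (h : ∀ a, τ.pos a τ.len = I.goal a) :
    soc I τ = ∑ a, walkCost I a (τ.pos a) τ.len :=
  Finset.sum_congr rfl fun a _ => by
    rw [Finset.sum_range_succ, h a, runningCost_goal, add_zero, walkCost]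

theorem IsSolution.jointCost_eq_soc [Fintype A] (hτ : IsSolution I Finset.univ x τ) :
    jointCost I Finset.univ τ.pos τ.len = (soc I τ : ℕ∞) := by
  rw [jointCost_of_goal hτ.target, soc_eq_sum_walkCost fun a => hτ.target a (Finset.mem_univ a)]

end Trajectories

/-! ## Termination of transition systems -/

section Termination

variable {α : Type*} {init : α → Prop} {step : α → α → Prop} {final : α → Prop}

theorem terminates_of_potential (P : α → Prop) (μ : α → ℕ) (N : ℕ) (hex : ∃ s, init s)
    (hinit : ∀ s, init s → P s ∧ μ s ≤ N)
    (hstep : ∀ s s', P s → step s s' → P s' ∧ μ s' < μ s)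
    (hprog : ∀ s, P s → ¬ final s → ∃ s', step s s') : Terminates init step final := by
  refine ⟨hex, ⟨N, fun k f h0 hf => ?_⟩, fun s₀ s h0 hs => hprog s ?_⟩
  · have key : ∀ i ≤ k, P (f i) ∧ μ (f i) + i ≤ N := by
      intro i hi
      induction i with
      | zero => simpa using hinit _ h0
      | succ i ih =>
        obtain ⟨hP, hμ⟩ := ih (by omega)
        obtain ⟨hP', hμ'⟩ := hstep _ _ hP (hf i hi)
        exact ⟨hP', by omega⟩
    have := (key k le_rfl).2
    omega
  · induction hs with
    | refl => exact (hinit _ h0).1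
    | tail _ hst ih => exact (hstep _ _ ih hst).1

theorem Terminates.exists_final (h : Terminates init step final) :
    ∃ s₀ s, init s₀ ∧ Relation.ReflTransGen step s₀ s ∧ final s := by
  obtain ⟨⟨s₀, h0⟩, ⟨N, hN⟩, hprog⟩ := h
  by_contra! hno
  have hruns : ∀ k : ℕ, ∃ f : ℕ → α, f 0 = s₀ ∧ (∀ i < k, step (f i) (f (i + 1))) ∧
      Relation.ReflTransGen step s₀ (f k) := by
    intro k
    induction k with
    | zero => exact ⟨fun _ => s₀, rfl, by simp, .refl⟩
    | succ k ih =>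
      obtain ⟨f, hf0, hf, hfk⟩ := ih
      obtain ⟨s', hs'⟩ := hprog s₀ (f k) h0 hfk (hno _ _ h0 hfk)
      refine ⟨fun i => if i ≤ k then f i else s', by simpa using hf0, fun i hi => ?_,
        by simpa using hfk.tail hs'⟩
      rcases Nat.lt_succ_iff_lt_or_eq.1 hi with hi | rfl
      · simpa [hi.le, Nat.succ_le_of_lt hi] using hf i hi
      · simpa using hs'
  obtain ⟨f, hf0, hf, -⟩ := hruns (N + 1)
  have := hN (N + 1) f (hf0 ▸ h0) hf
  omega

end Termination

/-! ## Constraints -/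

section Constraints

variable {A V : Type*}

/-- The constraint concerns only the times `0, …, h`. -/
def Constraint.Before (h : ℕ) : Constraint A V → Prop
  | .vertex _ t _ => t ≤ h
  | .edge _ t _ _ => t + 1 ≤ h

theorem Constraint.Before.mono {h k : ℕ} (hhk : h ≤ k) {c : Constraint A V} (hc : c.Before h) :
    c.Before k := by
  cases c <;> exact le_trans (by exact hc) hhk

theorem Constraint.Before.obeyed_congr {h : ℕ} {c : Constraint A V} (hc : c.Before h) {a : A}
    {p q : ℕ → V} (hpq : ∀ t ≤ h, p t = q t) (hp : c.Obeyed a p) : c.Obeyed a q := by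
  cases c with
  | vertex b t v => intro hb; rw [← hpq t hc]; exact hp hb
  | edge b t u v =>
    intro hb
    rw [← hpq t ((Nat.le_succ t).trans hc), ← hpq (t + 1) hc]
    exact hp hb

theorem finite_setOf_before [Finite A] [Finite V] (h : ℕ) :
    {c : Constraint A V | c.Before h}.Finite := by
  refine ((Set.finite_range fun y : A × Fin (h + 1) × V =>
    Constraint.vertex y.1 y.2.1 y.2.2).union (Set.finite_range
      fun y : A × Fin (h + 1) × V × V => Constraint.edge y.1 y.2.1 y.2.2.1 y.2.2.2)).subset ?_
  rintro (⟨a, t, v⟩ | ⟨a, t, u, v⟩) hc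
  · exact .inl ⟨(a, ⟨t, Nat.lt_succ_of_le hc⟩, v), rfl⟩
  · exact .inr ⟨(a, ⟨t, Nat.lt_succ_of_lt hc⟩, u, v), rfl⟩

/-- Branching on a conflict of the agents `i` and `j` by means of the constraints `c` and `d`. -/
structure Splits (S : Finset A) (n : Node A V) (h : ℕ) (i j : A) (c d : Constraint A V) :
    Prop where
  left_mem : i ∈ S
  right_mem : j ∈ S
  left_before : c.Before h
  right_before : d.Before h
  left_other : ∀ b ≠ i, ∀ p, c.Obeyed b p
  right_other : ∀ b ≠ j, ∀ p, d.Obeyed b p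
  left_violated : ¬ c.Obeyed i (n.traj i)
  right_violated : ¬ d.Obeyed j (n.traj j)
  cover : ∀ q : A → ℕ → V, ConflictFree S q h → c.Obeyed i (q i) ∨ d.Obeyed j (q j)

variable {S : Finset A} {n : Node A V} {h : ℕ} {i j : A} {t : ℕ}

theorem VertexConflict.splits (hi : i ∈ S) (hj : j ∈ S) (hij : i ≠ j)
    (hc : VertexConflict (n.traj i) (n.traj j) h t) :
    Splits S n h i j (.vertex i t (n.traj i t)) (.vertex j t (n.traj j t)) where
  left_mem := hi
  right_mem := hj
  left_before := hc.1
  right_before := hc.1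
  left_other _ hb _ e := absurd e.symm hb
  right_other _ hb _ e := absurd e.symm hb
  left_violated hv := hv rfl rfl
  right_violated hv := hv rfl rfl
  cover q hq := by
    by_contra! hno
    simp only [Constraint.Obeyed, forall_const, ne_eq, not_not] at hno
    exact (hq i hi j hj hij t).1 ⟨hc.1, by rw [hno.1, hno.2, hc.2]⟩

theorem EdgeConflict.splits (hi : i ∈ S) (hj : j ∈ S) (hij : i ≠ j)
    (hc : EdgeConflict (n.traj i) (n.traj j) h t) :
    Splits S n h i j (.edge i t (n.traj i t) (n.traj i (t + 1)))
      (.edge j t (n.traj j t) (n.traj j (t + 1))) where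
  left_mem := hi
  right_mem := hj
  left_before := hc.1
  right_before := hc.1
  left_other _ hb _ e := absurd e.symm hb
  right_other _ hb _ e := absurd e.symm hb
  left_violated hv := hv rfl ⟨rfl, rfl⟩
  right_violated hv := hv rfl ⟨rfl, rfl⟩
  cover q hq := by
    by_contra! hno
    simp only [Constraint.Obeyed, forall_const, not_not] at hno
    obtain ⟨⟨h1, h2⟩, h3, h4⟩ := hno
    exact (hq i hi j hj hij t).2 ⟨hc.1, by rw [h1, h4, hc.2.1], by rw [h2, h3, hc.2.2]⟩

end Constraints

/-! ### Conflict-free joint walks of fixed length, the reference against which the search is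
compared. -/

section JointWalks

variable {A V : Type*} {I : Instance A V} {S : Finset A} {H : ℕ} {x : A → V}

/-- The trajectories `q` of the agents of `S` have length `H` and lead to their goals. -/
structure IsJointWalk (I : Instance A V) (S : Finset A) (H : ℕ) (x : A → V)
    (q : A → ℕ → V) : Prop where
  source : ∀ a ∈ S, q a 0 = x a
  moves : ∀ a ∈ S, ∀ t < H, I.graph.Adj (q a t) (q a (t + 1))
  target : ∀ a ∈ S, q a H = I.goal a
  conflictFree : ConflictFree S q H

theorem IsJointWalk.isFeasible {q : A → ℕ → V} (hq : IsJointWalk I S H x q) {a : A}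
    (ha : a ∈ S) {C : Finset (Constraint A V)} (hC : ∀ c ∈ C, c.Obeyed a (q a)) :
    IsFeasible I H x C a (q a) :=
  ⟨hq.source a ha, hq.moves a ha, hq.target a ha, hC⟩

end JointWalks

/-! ## Individual planning -/

section LowLevel

variable {A V : Type*} [DecidableEq V] {I : Instance A V} {H : ℕ} {x : A → V}
  {C : Finset (Constraint A V)} {a : A} {p : ℕ → V}

theorem exists_isBestResponse (h : ∃ p, IsFeasible I H x C a p) :
    ∃ p, IsBestResponse I H x C a p := by
  obtain ⟨p, hp, hmin⟩ := WellFounded.has_min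
    (InvImage.wf (fun p => trajCost I a p H) wellFounded_lt) {p | IsFeasible I H x C a p} h
  exact ⟨p, hp, fun q hq => not_lt.1 (hmin q hq)⟩

/-- An individually optimal trajectory proceeds optimally after the last constraint. -/
theorem IsBestResponse.trajCost_eq {h : ℕ} (hp : IsBestResponse I H x C a p) (hh : h ≤ H)
    (hC : ∀ c ∈ C, c.Before h) : trajCost I a p h = trajCost I a p H := by
  refine le_antisymm (trajCost_mono hh hp.1.moves) ?_
  -- The rest of `p` itself shows that `H - h` steps suffice, so a shortest path padded with waits
  -- is at the goal at time `H`.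
  have hgo : costToGo I a (p h) ≤ (H - h : ℕ) := pathDist_le
    ⟨fun s => p (h + s), rfl, by simpa [Nat.add_sub_cancel' hh] using hp.1.target,
      fun t ht => hp.1.moves (h + t) (by omega)⟩
  obtain ⟨q, hq0, hqm, hqg, hqc⟩ := exists_shortest_walk (ne_top_of_le_ne_top (by simp) hgo)
  -- All constraints concern times up to `h`, where the spliced walk coincides with `p`.
  have hfeas : IsFeasible I H x C a (splice p h q) :=
    ⟨by rw [splice_of_le hq0 (Nat.zero_le h), hp.1.source],
      fun t ht => splice_adj hq0 (fun _ => hp.1.moves t ht) fun _ => hqm _,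
      by rw [splice_of_ge hh, hqg _ hgo],
      fun c hc => (hC c hc).obeyed_congr (fun t ht => (splice_of_le hq0 ht).symm)
        (hp.1.obeys c hc)⟩
  refine (hp.2 _ hfeas).trans ?_
  rw [trajCost_of_goal hfeas.target, MAPF.trajCost_eq, ← Nat.add_sub_cancel' hh, walkCost_splice,
    Nat.cast_add]
  gcongr
  exact hqc _

end LowLevel

/-! ### Weights for the termination potential. -/

section Weights

variable {A V : Type*}

/-- Weight of a node in the potential that bounds the number of iterations. -/
def Node.weight (K : ℕ) (n : Node A V) : ℕ := 9 * 3 ^ (K - n.constraints.card)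

/-- Total weight of the nodes of the queue. -/
def queueWeight (K : ℕ) (Q : Multiset (Node A V)) : ℕ := (Q.map (Node.weight K)).sum

theorem queueWeight_add (K : ℕ) (Q R : Multiset (Node A V)) :
    queueWeight K (Q + R) = queueWeight K Q + queueWeight K R := by
  simp [queueWeight]

theorem queueWeight_cons (K : ℕ) (n : Node A V) (Q : Multiset (Node A V)) :
    queueWeight K (n ::ₘ Q) = n.weight K + queueWeight K Q := by
  simp [queueWeight]

end Weights

/-! ## Invariants of the constraint tree -/

section Nodes

variable {A V : Type*} [DecidableEq V] {I : Instance A V} {S : Finset A} {H : ℕ} {x : A → V}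

/-- The trajectories of the node are individually optimal, and its constraints concern the times
`0, …, h`. -/
structure NodeOk (I : Instance A V) (S : Finset A) (H : ℕ) (x : A → V) (h : ℕ)
    (n : Node A V) : Prop where
  best : ∀ a ∈ S, IsBestResponse I H x n.constraints a (n.traj a)
  before : ∀ c ∈ n.constraints, c.Before h

theorem NodeOk.mono {h k : ℕ} {n : Node A V} (hn : NodeOk I S H x h n) (hhk : h ≤ k) :
    NodeOk I S H x k n :=
  ⟨hn.best, fun c hc => (hn.before c hc).mono hhk⟩

/-- This makes the running horizon irrelevant for the selection of nodes: the order by prefix cost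
is the order by full cost. -/
theorem NodeOk.cost_eq {h : ℕ} {n : Node A V} (hn : NodeOk I S H x h n) (hh : h ≤ H) :
    n.cost I S h = n.cost I S H :=
  Finset.sum_congr rfl fun a ha => (hn.best a ha).trajCost_eq hh hn.before

/-- The trajectories `q` satisfy the constraints of the node. -/
def Node.Admits (S : Finset A) (n : Node A V) (q : A → ℕ → V) : Prop :=
  ∀ c ∈ n.constraints, ∀ a ∈ S, c.Obeyed a (q a)

/-- Each agent is optimal under constraints that `q` satisfies, and conflicts are ignored: the node
is a relaxation. -/
theorem NodeOk.cost_le {h : ℕ} {n : Node A V} {q : A → ℕ → V} (hn : NodeOk I S H x h n)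
    (hq : IsJointWalk I S H x q) (hnq : n.Admits S q) : n.cost I S H ≤ jointCost I S q H :=
  Finset.sum_le_sum fun a ha =>
    (hn.best a ha).2 _ (hq.isFeasible ha fun c hc => hnq c hc a ha)

theorem exists_rootGen (I : Instance A V) (S : Finset A) (H : ℕ) (x : A → V) :
    ∃ Q, RootGen I S H x Q := by
  classical
  by_cases h : ∀ a ∈ S, ∃ p, IsFeasible I H x ∅ a p
  · choose p hp using fun a ha => exists_isBestResponse (h a ha)
    exact ⟨_, .inl ⟨⟨∅, fun a => if ha : a ∈ S then p a ha else fun _ => x a⟩, rfl,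
      fun a ha => by simpa [ha] using hp a ha, rfl⟩⟩
  · push Not at h
    obtain ⟨a, ha, hno⟩ := h
    exact ⟨0, .inr ⟨⟨a, ha, fun ⟨p, hp⟩ => hno p hp⟩, rfl⟩⟩

theorem RootGen.nodeOk {Q : Multiset (Node A V)} (hQ : RootGen I S H x Q) (h : ℕ) :
    ∀ n ∈ Q, NodeOk I S H x h n := by
  rcases hQ with ⟨n, hc, hbest, rfl⟩ | ⟨-, rfl⟩
  · intro m hm
    rw [Multiset.mem_singleton.1 hm]
    exact ⟨hc ▸ hbest, by simp [hc]⟩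
  · simp

theorem RootGen.exists_admits {Q : Multiset (Node A V)} (hQ : RootGen I S H x Q)
    {q : A → ℕ → V} (hq : IsJointWalk I S H x q) : ∃ n ∈ Q, n.Admits S q := by
  rcases hQ with ⟨n, hc, -, rfl⟩ | ⟨⟨a, ha, hno⟩, -⟩
  · exact ⟨n, Multiset.mem_singleton_self n, by simp [Node.Admits, hc]⟩
  · exact absurd ⟨q a, hq.isFeasible ha (by simp)⟩ hno

variable [DecidableEq A] {n : Node A V} {a : A} {c : Constraint A V} {Q : Multiset (Node A V)}

theorem exists_childGen (I : Instance A V) (H : ℕ) (x : A → V) (n : Node A V) (a : A)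
    (c : Constraint A V) : ∃ Q, ChildGen I H x n a c Q := by
  by_cases h : ∃ p, IsFeasible I H x (insert c n.constraints) a p
  · obtain ⟨p, hp⟩ := exists_isBestResponse h
    exact ⟨_, .inl ⟨p, hp, rfl⟩⟩
  · exact ⟨0, .inr ⟨h, rfl⟩⟩

theorem ChildGen.nodeOk (hQ : ChildGen I H x n a c Q) {h : ℕ} (hn : NodeOk I S H x h n)
    (hc : c.Before h) (hother : ∀ b ≠ a, ∀ p, c.Obeyed b p) : ∀ m ∈ Q, NodeOk I S H x h m := by
  rcases hQ with ⟨p, hp, rfl⟩ | ⟨-, rfl⟩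
  · intro m hm
    rw [Multiset.mem_singleton.1 hm]
    refine ⟨fun b hb => ?_, ?_⟩
    · by_cases hba : b = a
      · subst hba
        simpa using hp
      -- The new constraint says nothing about `b`, so the old trajectory stays feasible and
      -- optimal.
      · obtain ⟨hf, hopt⟩ := hn.best b hb
        simp only [Function.update_of_ne hba]
        refine ⟨⟨hf.source, hf.moves, hf.target, ?_⟩, fun q hq => hopt q
          ⟨hq.source, hq.moves, hq.target, fun d hd => hq.obeys d (Finset.mem_insert_of_mem hd)⟩⟩
        exact Finset.forall_mem_insert _ _ _ |>.2 ⟨hother b hba _, hf.obeys⟩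
    · exact Finset.forall_mem_insert _ _ _ |>.2 ⟨hc, hn.before⟩
  · simp

/-- The trajectory `q a` is feasible for the child, so the child cannot have been omitted. -/
theorem ChildGen.exists_admits (hQ : ChildGen I H x n a c Q) (ha : a ∈ S)
    (hother : ∀ b ≠ a, ∀ p, c.Obeyed b p) {q : A → ℕ → V} (hq : IsJointWalk I S H x q)
    (hnq : n.Admits S q) (hc : c.Obeyed a (q a)) : ∃ m ∈ Q, m.Admits S q := by
  rcases hQ with ⟨p, -, rfl⟩ | ⟨hno, -⟩
  · refine ⟨_, Multiset.mem_singleton_self _, Finset.forall_mem_insert _ _ _ |>.2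
      ⟨fun b _ => ?_, hnq⟩⟩
    by_cases hba : b = a
    · rwa [hba]
    · exact hother b hba _
  · exact absurd ⟨q a, hq.isFeasible ha (Finset.forall_mem_insert _ _ _ |>.2
      ⟨hc, fun d hd => hnq d hd a ha⟩)⟩ hno

/-- The current trajectory violates `c` but obeys the constraints of `n`, so `c` is new. The
exponent in the weight drops by one, without truncation thanks to `hK`. -/
theorem ChildGen.weight_le (hQ : ChildGen I H x n a c Q) (ha : a ∈ S) {h : ℕ}
    (hn : NodeOk I S H x h n) (hv : ¬ c.Obeyed a (n.traj a)) (hc : c.Before h) {K : ℕ}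
    (hK : ∀ C : Finset (Constraint A V), (∀ d ∈ C, d.Before h) → C.card ≤ K) :
    3 * queueWeight K Q ≤ n.weight K := by
  rcases hQ with ⟨p, -, rfl⟩ | ⟨-, rfl⟩
  · have hnew : c ∉ n.constraints := fun hmem => hv ((hn.best a ha).1.obeys c hmem)
    have hcard := hK (insert c n.constraints)
      (Finset.forall_mem_insert _ _ _ |>.2 ⟨hc, hn.before⟩)
    rw [Finset.card_insert_of_notMem hnew] at hcard
    rw [queueWeight, Multiset.map_singleton, Multiset.sum_singleton, Node.weight, Node.weight,
      Finset.card_insert_of_notMem hnew,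
      show K - n.constraints.card = K - (n.constraints.card + 1) + 1 by omega, pow_succ]
    exact le_of_eq (by ring)
  · simp [queueWeight]

end Nodes

/-! ## Invariants of the search -/

section OpenNodes

variable {A V : Type*}

/-- The nodes in the queue and the node that is being examined. -/
def SearchState.openNodes (s : SearchState A V) : Multiset (Node A V) :=
  match s.phase with
  | .selecting => s.queue
  | .examining n => n ::ₘ s.queue
  | .found n => n ::ₘ s.queue
  | .exhausted => s.queue

theorem SearchState.openNodes_selecting {s : SearchState A V} (hs : s.phase = .selecting) :
    s.openNodes = s.queue := by
  simp [openNodes, hs]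

theorem SearchState.openNodes_examining {s : SearchState A V} {n : Node A V}
    (hs : s.phase = .examining n) : s.openNodes = n ::ₘ s.queue := by
  simp [openNodes, hs]

end OpenNodes

/-! ### Backup rollouts. -/

section Rollout

variable {A V : Type*} {I : Instance A V} {π : BackupController I} {S : Finset A} {x : A → V}

/-- The hypothesis `hx` is for the trivial rollout, which does not come from the controller and
whose conflict-freeness must be supplied. -/
theorem rollout_isSolution (hx : ∀ i ∈ S, ∀ j ∈ S, i ≠ j → x i ≠ x j) {τ : JointTraj A V}
    (h : rollout π S x = some τ) : IsSolution I S x τ := by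
  unfold rollout at h
  split at h
  next hg =>
    cases h
    exact ⟨fun a _ => rfl, fun a _ t ht => absurd ht (by simp), fun a ha => hg a ha,
      fun i hi j hj hij t => ⟨fun hc => hx i hi j hj hij hc.2, fun hc => absurd hc.1 (by simp)⟩⟩
  next => exact π.sound _ _ _ h

end Rollout

section Search

variable {A V : Type*} [DecidableEq V] {I : Instance A V} {π : BackupController I}
  {S : Finset A} {H : ℕ} {x : A → V}

theorem SearchState.updateCert_eq (s : SearchState A V) (n : Node A V) :
    s.updateCert π S n =
      { s with cert := (s.updateCert π S n).cert, budget := (s.updateCert π S n).budget } := by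
  unfold updateCert
  split
  · rfl
  · dsimp only
    split <;> rfl

@[simp] theorem SearchState.updateCert_queue (s : SearchState A V) (n : Node A V) :
    (s.updateCert π S n).queue = s.queue := by rw [updateCert_eq]

@[simp] theorem SearchState.updateCert_phase (s : SearchState A V) (n : Node A V) :
    (s.updateCert π S n).phase = s.phase := by rw [updateCert_eq]

@[simp] theorem SearchState.updateCert_horizon (s : SearchState A V) (n : Node A V) :
    (s.updateCert π S n).horizon = s.horizon := by rw [updateCert_eq]

/-- Invariant of the search. -/
structure SearchInv (I : Instance A V) (S : Finset A) (H : ℕ) (x : A → V)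
    (s : SearchState A V) : Prop where
  horizon_le : s.horizon ≤ H
  nodeOk : ∀ n ∈ s.openNodes, NodeOk I S H x s.horizon n

theorem SearchStart.inv (hH : 1 ≤ H) {c : JointTraj A V} {b : ℕ∞} {s : SearchState A V}
    (h : SearchStart I S H x c b s) : SearchInv I S H x s := by
  obtain ⟨hQ, hh, hp, -⟩ := h
  exact ⟨hh ▸ hH, by rw [SearchState.openNodes_selecting hp]; exact hQ.nodeOk _⟩

/-- Either the certificate is kept, or it is replaced by a cheaper solution. -/
theorem SearchState.updateCert_cases {s : SearchState A V} {n : Node A V}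
    (hn : NodeOk I S H x s.horizon n) (hh : s.horizon ≤ H)
    (hfree : ConflictFree S n.traj s.horizon) :
    ((s.updateCert π S n).cert = s.cert ∧ (s.updateCert π S n).budget = s.budget) ∨
    (IsSolution I S x (s.updateCert π S n).cert ∧
      (s.updateCert π S n).budget =
        jointCost I S (s.updateCert π S n).cert.pos (s.updateCert π S n).cert.len ∧
      (s.updateCert π S n).budget < s.budget) := by
  unfold updateCert
  split
  · exact .inl ⟨rfl, rfl⟩
  next σ hσ =>
    dsimp only
    split
    next hlt =>
      refine .inr ⟨isSolution_concatTraj (fun a ha => (hn.best a ha).1.source)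
        (fun a ha t ht => (hn.best a ha).1.moves t (by omega)) hfree
        (rollout_isSolution (fun i hi j hj hij e => ?_) hσ), rfl, hlt⟩
      exact (hfree i hi j hj hij s.horizon).1 ⟨le_rfl, e⟩
    next => exact .inl ⟨rfl, rfl⟩

/-- At the full horizon all agents are at their goals, so the rollout has length `0` and the
candidate is the joint walk of the node. -/
theorem SearchState.updateCert_budget_le {s : SearchState A V} {n : Node A V}
    (hn : NodeOk I S H x s.horizon n) (hh : s.horizon = H) :
    (s.updateCert π S n).budget ≤ n.cost I S H := by
  have hg : ∀ a ∈ S, n.traj a s.horizon = I.goal a := fun a ha => hh ▸ (hn.best a ha).1.target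
  have hcand : ∀ σ : JointTraj A V, σ.len = 0 →
      jointCost I S (concatTraj n.traj s.horizon σ).pos (concatTraj n.traj s.horizon σ).len =
        n.cost I S H := by
    intro σ hσ
    rw [concatTraj, hσ, add_zero, Node.cost, ← hh]
    exact jointCost_congr fun a _ t ht => if_pos ht
  rw [updateCert, rollout, if_pos hg]
  dsimp only
  rw [hcand _ rfl]
  split
  next => exact le_rfl
  next h => exact not_lt.1 h

variable [DecidableEq A]

theorem SearchInv.exists_step {s : SearchState A V} (hs : SearchInv I S H x s)
    (hhalt : ¬ s.Halted) : ∃ s', SearchStep I π S H x s s' := by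
  rcases hp : s.phase with _ | n | n | _
  · by_cases hQ : s.queue = 0
    · exact ⟨_, .exhaust s hp hQ⟩
    · obtain ⟨n, hn, hmin⟩ := s.queue.exists_min_image (Node.cost I S s.horizon) hQ
      obtain ⟨Q, hQ⟩ := Multiset.exists_cons_of_mem hn
      exact ⟨_, .dequeue s n Q hp hQ fun m hm => hmin m (hQ ▸ Multiset.mem_cons_of_mem hm)⟩
  · by_cases hfree : ConflictFree S n.traj s.horizon
    · rcases hs.horizon_le.lt_or_eq with hh | hh
      · exact ⟨_, .extend s n hp hfree hh⟩
      · exact ⟨_, .finish s n hp hfree hh⟩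
    · unfold ConflictFree at hfree
      push Not at hfree
      obtain ⟨i, hi, j, hj, hij, t, hc⟩ := hfree
      by_cases hv : VertexConflict (n.traj i) (n.traj j) s.horizon t
      · obtain ⟨Qi, hQi⟩ := exists_childGen I H x n i (.vertex i t (n.traj i t))
        obtain ⟨Qj, hQj⟩ := exists_childGen I H x n j (.vertex j t (n.traj j t))
        exact ⟨_, .branchVertex s n hp i j hi hj hij t hv Qi Qj hQi hQj⟩
      · obtain ⟨Qi, hQi⟩ := exists_childGen I H x n i
          (.edge i t (n.traj i t) (n.traj i (t + 1)))
        obtain ⟨Qj, hQj⟩ := exists_childGen I H x n j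
          (.edge j t (n.traj j t) (n.traj j (t + 1)))
        exact ⟨_, .branchEdge s n hp i j hi hj hij t (hc hv) Qi Qj hQi hQj⟩
  · exact absurd (.inl ⟨n, hp⟩) hhalt
  · exact absurd (.inr hp) hhalt

theorem SearchInv.branch {s : SearchState A V} (hs : SearchInv I S H x s) {n : Node A V}
    (hp : s.phase = .examining n) {i j : A} {c d : Constraint A V}
    (hsplit : Splits S n s.horizon i j c d) {Qi Qj : Multiset (Node A V)}
    (hQi : ChildGen I H x n i c Qi) (hQj : ChildGen I H x n j d Qj) :
    SearchInv I S H x { s with queue := s.queue + Qi + Qj, phase := .selecting } := by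
  have hok := hs.nodeOk
  rw [SearchState.openNodes_examining hp] at hok
  have hn := hok n (Multiset.mem_cons_self _ _)
  refine ⟨hs.horizon_le, fun m hm => ?_⟩
  rw [SearchState.openNodes_selecting rfl, Multiset.mem_add, Multiset.mem_add] at hm
  rcases hm with (hm | hm) | hm
  · exact hok m (Multiset.mem_cons_of_mem hm)
  · exact hQi.nodeOk hn hsplit.left_before hsplit.left_other m hm
  · exact hQj.nodeOk hn hsplit.right_before hsplit.right_other m hm

theorem SearchInv.step {s s' : SearchState A V} (hs : SearchInv I S H x s)
    (h : SearchStep I π S H x s s') : SearchInv I S H x s' := by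
  have hok := hs.nodeOk
  cases h with
  | dequeue n Q hp hQ hmin =>
    rw [SearchState.openNodes_selecting hp, hQ] at hok
    exact ⟨hs.horizon_le, hok⟩
  | exhaust hp hQ =>
    rw [SearchState.openNodes_selecting hp] at hok
    exact ⟨hs.horizon_le, hok⟩
  | branchVertex n hp i j hi hj hij t hc Qi Qj hQi hQj =>
    exact hs.branch hp (hc.splits hi hj hij) hQi hQj
  | branchEdge n hp i j hi hj hij t hc Qi Qj hQi hQj =>
    exact hs.branch hp (hc.splits hi hj hij) hQi hQj
  | extend n hp hfree hh =>
    rw [SearchState.openNodes_examining hp] at hok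
    refine ⟨hh, fun m hm => ?_⟩
    rw [SearchState.openNodes_examining (n := n) (by simpa using hp)] at hm
    exact (hok m (by simpa using hm)).mono (Nat.le_succ _)
  | finish n hp hfree hh =>
    rw [SearchState.openNodes_examining hp] at hok
    refine ⟨by simpa using hs.horizon_le, fun m hm => ?_⟩
    simpa using hok m (by simpa [SearchState.openNodes] using hm)

theorem SearchInv.cert_cases {s s' : SearchState A V} (hs : SearchInv I S H x s)
    (h : SearchStep I π S H x s s') :
    (s'.cert = s.cert ∧ s'.budget = s.budget) ∨
    (IsSolution I S x s'.cert ∧ s'.budget = jointCost I S s'.cert.pos s'.cert.len ∧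
      s'.budget < s.budget) := by
  have hok := hs.nodeOk
  cases h with
  | extend n hp hfree hh =>
    rw [SearchState.openNodes_examining hp] at hok
    exact SearchState.updateCert_cases (hok n (Multiset.mem_cons_self _ _)) hs.horizon_le hfree
  | finish n hp hfree hh =>
    rw [SearchState.openNodes_examining hp] at hok
    exact SearchState.updateCert_cases (hok n (Multiset.mem_cons_self _ _)) hs.horizon_le hfree
  | _ => exact .inl ⟨rfl, rfl⟩

/-- The potential that decreases in every iteration of the search. -/
def SearchState.potential (K H : ℕ) (s : SearchState A V) : ℕ :=
  queueWeight K s.queue + (H - s.horizon) +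
    match s.phase with
    | .selecting => 1
    | .examining n => n.weight K - 1
    | .found _ => 0
    | .exhausted => 0

theorem potential_branch_lt {s : SearchState A V} (hs : SearchInv I S H x s) {n : Node A V}
    (hp : s.phase = .examining n) {i j : A} {c d : Constraint A V}
    (hsplit : Splits S n s.horizon i j c d) {Qi Qj : Multiset (Node A V)}
    (hQi : ChildGen I H x n i c Qi) (hQj : ChildGen I H x n j d Qj) {K : ℕ}
    (hK : ∀ C : Finset (Constraint A V), (∀ d ∈ C, d.Before H) → C.card ≤ K) :
    SearchState.potential K H { s with queue := s.queue + Qi + Qj, phase := .selecting } <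
      s.potential K H := by
  have hn : NodeOk I S H x s.horizon n := hs.nodeOk n (by
    rw [SearchState.openNodes_examining hp]; exact Multiset.mem_cons_self _ _)
  have hnH := hn.mono hs.horizon_le
  have hi := hQi.weight_le hsplit.left_mem hnH hsplit.left_violated
    (hsplit.left_before.mono hs.horizon_le) hK
  have hj := hQj.weight_le hsplit.right_mem hnH hsplit.right_violated
    (hsplit.right_before.mono hs.horizon_le) hK
  -- Both children together weigh at most `2w/3`, where `w` is the weight of `n`, and the phase term
  -- changes from `w - 1` to `1`. The decrease needs `2w/3 + 1 < w - 1`, that is `w > 6`; the factor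
  -- `9` ensures it.
  have hw : 9 ≤ n.weight K := Nat.le_mul_of_pos_right _ (by positivity)
  simp only [SearchState.potential, hp, queueWeight_add]
  omega

theorem SearchInv.potential_lt {s s' : SearchState A V} (hs : SearchInv I S H x s)
    (h : SearchStep I π S H x s s') {K : ℕ}
    (hK : ∀ C : Finset (Constraint A V), (∀ d ∈ C, d.Before H) → C.card ≤ K) :
    s'.potential K H < s.potential K H := by
  have hw : ∀ n : Node A V, 9 ≤ n.weight K := fun n =>
    Nat.le_mul_of_pos_right _ (by positivity)
  cases h with
  | dequeue n Q hp hQ hmin =>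
    have := hw n
    simp only [SearchState.potential, hp, hQ, queueWeight_cons]
    omega
  | exhaust hp hQ => simp [SearchState.potential, hp, hQ]
  | branchVertex n hp i j hi hj hij t hc Qi Qj hQi hQj =>
    exact potential_branch_lt hs hp (hc.splits hi hj hij) hQi hQj hK
  | branchEdge n hp i j hi hj hij t hc Qi Qj hQi hQj =>
    exact potential_branch_lt hs hp (hc.splits hi hj hij) hQi hQj hK
  | extend n hp hfree hh =>
    simp only [SearchState.potential, SearchState.updateCert_queue, SearchState.updateCert_phase,
      hp]
    omega
  | finish n hp hfree hh =>
    have := hw n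
    simp only [SearchState.potential, SearchState.updateCert_queue,
      SearchState.updateCert_horizon, hp]
    omega

theorem search_terminates [Finite A] [Finite V] (hH : 1 ≤ H) (c : JointTraj A V) (b : ℕ∞) :
    Terminates (SearchStart I S H x c b) (SearchStep I π S H x) SearchState.Halted := by
  obtain ⟨K, hK⟩ : ∃ K, ∀ C : Finset (Constraint A V), (∀ d ∈ C, d.Before H) → C.card ≤ K := by
    refine ⟨(finite_setOf_before H).toFinset.card, fun C hC => Finset.card_le_card fun d hd => ?_⟩
    simpa using hC d hd
  obtain ⟨Q, hQ⟩ := exists_rootGen I S H x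
  -- The root weighs `9 * 3 ^ K`; the summands `H` and `1` bound the horizon term and the initial
  -- phase term.
  refine terminates_of_potential (SearchInv I S H x) (SearchState.potential K H)
    (9 * 3 ^ K + H + 1) ⟨⟨Q, 1, .selecting, c, b⟩, hQ, rfl, rfl, rfl, rfl⟩
    (fun s hs => ⟨hs.inv hH, ?_⟩) (fun s s' hs h => ⟨hs.step h, hs.potential_lt h hK⟩)
    fun s hs => hs.exists_step
  obtain ⟨hQ, -, hp, -⟩ := hs
  simp only [SearchState.potential, hp]
  have hroot : queueWeight K s.queue ≤ 9 * 3 ^ K := by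
    rcases hQ with ⟨n, hc, -, hQ⟩ | ⟨-, hQ⟩ <;> simp [hQ, queueWeight, Node.weight]
    simp [hc]
  omega

/-- An incumbent that is no more expensive than any solution is never replaced. -/
theorem search_cert_eq (hH : 1 ≤ H) {c : JointTraj A V} {b : ℕ∞}
    (hopt : ∀ σ, IsSolution I S x σ → b ≤ jointCost I S σ.pos σ.len) {s₀ s : SearchState A V}
    (h0 : SearchStart I S H x c b s₀) (h : Relation.ReflTransGen (SearchStep I π S H x) s₀ s) :
    s.cert = c ∧ s.budget = b := by
  suffices SearchInv I S H x s ∧ s.cert = c ∧ s.budget = b from this.2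
  induction h with
  | refl => exact ⟨h0.inv hH, h0.2.2.2.1, h0.2.2.2.2⟩
  | tail _ hst ih =>
    obtain ⟨hinv, hc, hb⟩ := ih
    refine ⟨hinv.step hst, ?_⟩
    rcases hinv.cert_cases hst with h | ⟨hsol, hcost, hlt⟩
    · exact ⟨h.1.trans hc, h.2.trans hb⟩
    · rw [hcost, hb] at hlt
      exact absurd (hopt _ hsol) hlt.not_ge

/-- For the first control step, where the incumbent need not be optimal and may be replaced. -/
theorem search_cert_isSolution (hH : 1 ≤ H) {c : JointTraj A V} (hc : IsSolution I S x c)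
    {s₀ s : SearchState A V} (h0 : SearchStart I S H x c (jointCost I S c.pos c.len) s₀)
    (h : Relation.ReflTransGen (SearchStep I π S H x) s₀ s) :
    IsSolution I S x s.cert ∧ s.budget = jointCost I S s.cert.pos s.cert.len := by
  suffices SearchInv I S H x s ∧ IsSolution I S x s.cert ∧
    s.budget = jointCost I S s.cert.pos s.cert.len from this.2
  induction h with
  | refl =>
    obtain ⟨-, -, -, e, e'⟩ := id h0
    exact ⟨h0.inv hH, e.symm ▸ hc, by rw [e', e]⟩
  | tail _ hst ih =>
    obtain ⟨hinv, hc, hb⟩ := ih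
    refine ⟨hinv.step hst, ?_⟩
    rcases hinv.cert_cases hst with h | ⟨hsol, hcost, -⟩
    · rw [h.1, h.2]
      exact ⟨hc, hb⟩
    · exact ⟨hsol, hcost⟩

/-- The search keeps a node whose constraints are satisfied by `q`, and thus examines only nodes
that are no more expensive than `q`. -/
def SearchOpt (I : Instance A V) (S : Finset A) (H : ℕ) (q : A → ℕ → V)
    (s : SearchState A V) : Prop :=
  match s.phase with
  | .selecting => ∃ m ∈ s.queue, m.Admits S q
  | .examining n => n.cost I S H ≤ jointCost I S q H ∧ ∃ m ∈ n ::ₘ s.queue, m.Admits S q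
  | .found n => s.horizon = H ∧ ConflictFree S n.traj H ∧ n.cost I S H ≤ jointCost I S q H ∧
      s.budget ≤ n.cost I S H
  | .exhausted => False

theorem searchOpt_branch {q : A → ℕ → V} (hq : IsJointWalk I S H x q) {s : SearchState A V}
    (hs : SearchInv I S H x s) {n : Node A V} (hp : s.phase = .examining n)
    (hopt : SearchOpt I S H q s) {i j : A} {c d : Constraint A V}
    (hsplit : Splits S n s.horizon i j c d) {Qi Qj : Multiset (Node A V)}
    (hQi : ChildGen I H x n i c Qi) (hQj : ChildGen I H x n j d Qj) :
    SearchOpt I S H q { s with queue := s.queue + Qi + Qj, phase := .selecting } := by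
  simp only [SearchOpt, hp] at hopt ⊢
  obtain ⟨-, m, hm, hmq⟩ := hopt
  rcases Multiset.mem_cons.1 hm with rfl | hm
  -- The witness is the node being branched on. As `q` has no conflict, it obeys one of the two new
  -- constraints, and that child takes over.
  · rcases hsplit.cover q (hq.conflictFree.mono hs.horizon_le) with h | h
    · obtain ⟨m', hm', h'⟩ := hQi.exists_admits hsplit.left_mem hsplit.left_other hq hmq h
      exact ⟨m', by simp [hm'], h'⟩
    · obtain ⟨m', hm', h'⟩ := hQj.exists_admits hsplit.right_mem hsplit.right_other hq hmq h
      exact ⟨m', by simp [hm'], h'⟩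
  · exact ⟨m, by simp [hm], hmq⟩

theorem SearchInv.searchOpt_step {q : A → ℕ → V} (hq : IsJointWalk I S H x q)
    {s s' : SearchState A V} (hs : SearchInv I S H x s) (hopt : SearchOpt I S H q s)
    (h : SearchStep I π S H x s s') : SearchOpt I S H q s' := by
  have hok := hs.nodeOk
  cases h with
  | dequeue n Q hp hQ hmin =>
    rw [SearchState.openNodes_selecting hp, hQ] at hok
    simp only [SearchOpt, hp, hQ] at hopt ⊢
    obtain ⟨m, hm, hmq⟩ := hopt
    refine ⟨?_, m, hm, hmq⟩
    have hle : n.cost I S s.horizon ≤ m.cost I S s.horizon := by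
      rcases Multiset.mem_cons.1 hm with rfl | hm
      · exact le_rfl
      · exact hmin m hm
    -- The queue compares costs at the running horizon; both sides are now read at `H`.
    rw [(hok n (Multiset.mem_cons_self _ _)).cost_eq hs.horizon_le,
      (hok m hm).cost_eq hs.horizon_le] at hle
    exact hle.trans ((hok m hm).cost_le hq hmq)
  | exhaust hp hQ => simp [SearchOpt, hp, hQ] at hopt
  | branchVertex n hp i j hi hj hij t hc Qi Qj hQi hQj =>
    exact searchOpt_branch hq hs hp hopt (hc.splits hi hj hij) hQi hQj
  | branchEdge n hp i j hi hj hij t hc Qi Qj hQi hQj =>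
    exact searchOpt_branch hq hs hp hopt (hc.splits hi hj hij) hQi hQj
  | extend n hp hfree hh =>
    simpa only [SearchOpt, hp, SearchState.updateCert_queue, SearchState.updateCert_phase]
      using hopt
  | finish n hp hfree hh =>
    rw [SearchState.openNodes_examining hp] at hok
    simp only [SearchOpt, hp, SearchState.updateCert_horizon] at hopt ⊢
    exact ⟨hh, hh ▸ hfree, hopt.1,
      SearchState.updateCert_budget_le (hok n (Multiset.mem_cons_self _ _)) hh⟩

/-- Optimality of the search. -/
theorem search_found (hH : 1 ≤ H) {q : A → ℕ → V} (hq : IsJointWalk I S H x q)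
    {c : JointTraj A V} {b : ℕ∞} {s₀ s : SearchState A V} (h0 : SearchStart I S H x c b s₀)
    (h : Relation.ReflTransGen (SearchStep I π S H x) s₀ s) (hs : s.Halted) :
    ∃ n, s.phase = .found n ∧ s.horizon = H ∧ IsSolution I S x ⟨H, n.traj⟩ ∧
      n.cost I S H ≤ jointCost I S q H ∧ s.budget ≤ n.cost I S H := by
  obtain ⟨hinv, hopt⟩ : SearchInv I S H x s ∧ SearchOpt I S H q s := by
    clear hs
    induction h with
    | refl =>
      refine ⟨h0.inv hH, ?_⟩
      obtain ⟨hQ, -, hp, -⟩ := h0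
      simpa only [SearchOpt, hp] using hQ.exists_admits hq
    | tail _ hst ih => exact ⟨ih.1.step hst, ih.1.searchOpt_step hq ih.2 hst⟩
  rcases hs with ⟨n, hp⟩ | hp
  · have hn : NodeOk I S H x s.horizon n := hinv.nodeOk n (by simp [SearchState.openNodes, hp])
    simp only [SearchOpt, hp] at hopt
    obtain ⟨hh, hfree, hle, hb⟩ := hopt
    exact ⟨n, hp, hh, ⟨fun a ha => (hn.best a ha).1.source, fun a ha => (hn.best a ha).1.moves,
      fun a ha => (hn.best a ha).1.target, hfree⟩, hle, hb⟩
  · simp only [SearchOpt, hp] at hopt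

end Search

/-! ## Optimality of the remainder of an optimal solution -/

section Remainder

variable {A V : Type*} {I : Instance A V} {S : Finset A} {x : A → V} {τ : JointTraj A V}

theorem isSolution_of_loc (h0 : ∀ a ∈ S, τ.loc a 0 = x a)
    (hm : ∀ a ∈ S, ∀ t, I.graph.Adj (τ.loc a t) (τ.loc a (t + 1)))
    (hg : ∀ a ∈ S, τ.loc a τ.len = I.goal a) (hc : ConflictFree S τ.loc τ.len) :
    IsSolution I S x τ := by
  refine ⟨fun a ha => ?_, fun a ha t ht => ?_, fun a ha => ?_, fun i hi j hj hij t =>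
    ⟨fun h => ?_, fun h => ?_⟩⟩
  · rw [← h0 a ha, JointTraj.loc_of_le (Nat.zero_le _)]
  · rw [← JointTraj.loc_of_le ht.le, ← JointTraj.loc_of_le ht]
    exact hm a ha t
  · rw [← hg a ha, JointTraj.loc_of_le le_rfl]
  · refine (hc i hi j hj hij t).1 ⟨h.1, ?_⟩
    rw [JointTraj.loc_of_le h.1, JointTraj.loc_of_le h.1, h.2]
  · have h1 := h.1
    refine (hc i hi j hj hij t).2 ⟨h1, ?_⟩
    rw [JointTraj.loc_of_le h1, JointTraj.loc_of_le h1, JointTraj.loc_of_le (by omega),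
      JointTraj.loc_of_le (by omega)]
    exact h.2

theorem IsSolution.mono {S' : Finset A} (hτ : IsSolution I S x τ) (hS : S' ⊆ S) :
    IsSolution I S' x τ :=
  ⟨fun a ha => hτ.source a (hS ha), fun a ha => hτ.moves a (hS ha),
    fun a ha => hτ.target a (hS ha),
    fun i hi j hj => hτ.conflictFree i (hS hi) j (hS hj)⟩

theorem IsSolution.tail_iterate (hτ : IsSolution I S x τ) (t : ℕ) :
    IsSolution I S (fun a => τ.loc a t) (JointTraj.tail^[t] τ) := by
  refine isSolution_of_loc (fun a _ => by rw [JointTraj.loc_tail_iterate, add_zero])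
    (fun a ha s => ?_) (fun a ha => ?_) fun i hi j hj hij s => ⟨fun h => ?_, fun h => ?_⟩
  · rw [JointTraj.loc_tail_iterate, JointTraj.loc_tail_iterate]
    exact hτ.loc_adj ha (t + s)
  · rw [JointTraj.loc_tail_iterate, JointTraj.len_tail_iterate, hτ.loc_goal ha (by omega)]
  · have h2 := h.2
    simp only [JointTraj.loc_tail_iterate] at h2
    exact hτ.loc_ne hi hj hij _ h2
  · have h2 := h.2
    simp only [JointTraj.loc_tail_iterate] at h2
    exact hτ.loc_not_swap hi hj hij _ h2

variable [DecidableEq V]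

/-- Cost of the agents of `S` from time `t` on. -/
def remCost (I : Instance A V) (τ : JointTraj A V) (S : Finset A) (t : ℕ) : ℕ :=
  ∑ a ∈ S, walkCost I a (fun s => τ.loc a (t + s)) (τ.len - t)

/-- Any number of vertices reaching the end of `τ` gives the same cost, since the agents then rest
at their goals. -/
theorem IsSolution.remCost_eq (hτ : IsSolution I S x τ) (t : ℕ) {n : ℕ} (hn : τ.len ≤ t + n) :
    remCost I τ S t = ∑ a ∈ S, walkCost I a (fun s => τ.loc a (t + s)) n :=
  Finset.sum_congr rfl fun a ha => (walkCost_of_goal (by omega)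
    fun s hs => hτ.loc_goal ha (by omega)).symm

theorem IsSolution.jointCost_tail_iterate (hτ : IsSolution I S x τ) (t : ℕ) :
    jointCost I S (JointTraj.tail^[t] τ).pos (JointTraj.tail^[t] τ).len =
      (remCost I τ S t : ℕ∞) := by
  rw [(hτ.tail_iterate t).jointCost_eq le_rfl, JointTraj.len_tail_iterate]
  simp only [remCost, funext (JointTraj.loc_tail_iterate t _)]

theorem IsSolution.remCost_succ (hτ : IsSolution I S x τ) (t : ℕ) :
    remCost I τ S t = ∑ a ∈ S, runningCost I a (τ.loc a t) + remCost I τ S (t + 1) := by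
  rw [hτ.remCost_eq t (n := 1 + τ.len) (by omega), hτ.remCost_eq (t + 1) (n := τ.len) (by omega),
    ← Finset.sum_add_distrib]
  refine Finset.sum_congr rfl fun a _ => ?_
  rw [walkCost_add]
  simp [walkCost, add_assoc]

theorem IsSolution.remCost_zero [Fintype A] (hτ : IsSolution I Finset.univ x τ) :
    remCost I τ Finset.univ 0 = soc I τ := by
  have h := hτ.jointCost_tail_iterate 0
  rw [Function.iterate_zero, id, hτ.jointCost_eq_soc] at h
  exact_mod_cast h.symm

/-- Agents that move more cheaply than budgeted remain in their regions. -/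
theorem mem_region {B M : ℕ} {p : A → ℕ → V} (h0 : ∀ b ∈ S, p b 0 = x b)
    (hm : ∀ b ∈ S, ∀ t < M, I.graph.Adj (p b t) (p b (t + 1)))
    (hg : ∀ b ∈ S, p b M = I.goal b) (hlt : ∑ b ∈ S, walkCost I b (p b) M < B) {a : A}
    (ha : a ∈ S) {s : ℕ} (hs : s ≤ M) : p a s ∈ region I x (slackness I x S B) a := by
  classical
  have hγ : ∀ b ∈ S, costToGo I b (x b) ≤ walkCost I b (p b) M := fun b hb =>
    h0 b hb ▸ costToGo_le_walkCost (hm b hb) (hg b hb)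
  -- All distances are finite because the walks reach the goals, so the truncated subtractions can
  -- be settled in `ℕ`.
  have hlift : ∀ b ∈ S, ((costToGo I b (x b)).toNat : ℕ∞) = costToGo I b (x b) := fun b hb =>
    ENat.natCast_toNat (ne_top_of_le_ne_top (by simp) (hγ b hb))
  have hle : ∀ b ∈ S, (costToGo I b (x b)).toNat ≤ walkCost I b (p b) M := fun b hb => by
    have := hγ b hb
    rw [← hlift b hb] at this
    exact_mod_cast this
  have hD := pathDist_add_costToGo_le hs (hm a ha) (hg a ha)
  rw [h0 a ha] at hD
  have hsum := Finset.sum_le_sum fun b hb => hle b (Finset.mem_of_mem_erase (a := a) hb)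
  rw [← Finset.add_sum_erase _ _ ha] at hlt
  rw [region, Set.mem_ofPred_eq, tsub_le_iff_right, slackness,
    ← Finset.sum_congr rfl hlift, ← hlift a ha, ← Nat.cast_sum, ← ENat.natCast_sub]
  -- The strict inequality `hlt` absorbs the `1` for the free move out of the goal. The other agents
  -- pay at least their distances, so the detour of `a` fits into the slackness.
  refine hD.trans ?_
  rw [← Finset.add_sum_erase _ _ ha]
  have := hle a ha
  norm_cast
  omega

/-- At some time up to `t` the agents `a` and `b` belonged to a common group that comprised `S'`,
and their regions were disjoint. -/
def Separated (I : Instance A V) (τ : JointTraj A V) (t : ℕ) (S' : Finset A) (a b : A) : Prop :=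
  ∃ t₀ ≤ t, ∃ S, S' ⊆ S ∧ b ∈ S ∧
    Disjoint
      (region I (fun a => τ.loc a t₀) (slackness I (fun a => τ.loc a t₀) S (remCost I τ S t₀)) a)
      (region I (fun a => τ.loc a t₀) (slackness I (fun a => τ.loc a t₀) S (remCost I τ S t₀)) b)

/-- No solution for a separated group is cheaper than the remainder of an optimal solution. -/
theorem IsSOCOptimal.remCost_le [Fintype A] [DecidableEq A] (hτ : IsSOCOptimal I τ) {t : ℕ}
    (hsep : ∀ a ∈ S, ∀ b ∉ S, Separated I τ t S a b) {c : JointTraj A V}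
    (hc : IsSolution I S (fun a => τ.loc a t) c) :
    (remCost I τ S t : ℕ∞) ≤ jointCost I S c.pos c.len := by
  obtain ⟨hsol, hopt⟩ := hτ
  have hu : ∀ a : A, a ∈ Finset.univ := Finset.mem_univ
  have hsolS : ∀ S : Finset A, IsSolution I S I.start τ := fun S => hsol.mono (Finset.subset_univ S)
  -- Long enough for both `c` and the rest of `τ` to be at the goals.
  set N := c.len + τ.len with hN
  rw [hc.jointCost_eq (n := N) (by omega), (hsolS S).remCost_eq t (n := N) (by omega)]
  by_contra! hlt
  replace hlt : ∑ a ∈ S, walkCost I a (c.loc a) N <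
      ∑ a ∈ S, walkCost I a (fun s => τ.loc a (t + s)) N := by exact_mod_cast hlt
  let w : A → ℕ → V := fun a => if a ∈ S then splice (τ.loc a) t (c.loc a) else τ.loc a
  have hwS : ∀ a ∈ S, w a = splice (τ.loc a) t (c.loc a) := fun a ha => if_pos ha
  have hwS' : ∀ a ∉ S, w a = τ.loc a := fun a ha => if_neg ha
  have hwle : ∀ a s, s ≤ t → w a s = τ.loc a s := by
    intro a s hs
    by_cases ha : a ∈ S
    · rw [hwS a ha, splice_of_le (hc.loc_zero ha) hs]
    · rw [hwS' a ha]
  have hwge : ∀ a ∈ S, ∀ s, t ≤ s → w a s = c.loc a (s - t) := fun a ha s hs => by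
    rw [hwS a ha, splice_of_ge hs]
  have hwm : ∀ a s, I.graph.Adj (w a s) (w a (s + 1)) := by
    intro a s
    by_cases ha : a ∈ S
    · rw [hwS a ha]
      exact splice_adj (hc.loc_zero ha) (fun _ => hsol.loc_adj (hu a) s) fun _ => hc.loc_adj ha _
    · rw [hwS' a ha]
      exact hsol.loc_adj (hu a) s
  have hwg : ∀ a, w a (t + N) = I.goal a := by
    intro a
    by_cases ha : a ∈ S
    · rw [hwge a ha _ (by omega), hc.loc_goal ha (by omega)]
    · rw [hwS' a ha, hsol.loc_goal (hu a) (by omega)]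
  -- The saving inside `S` persists in every larger group and from every earlier time, because `w`
  -- equals `τ` up to `t` and outside `S`.
  have hcost : ∀ t₀ ≤ t, ∀ S', S ⊆ S' →
      ∑ a ∈ S', walkCost I a (fun s => w a (t₀ + s)) (t - t₀ + N) < remCost I τ S' t₀ := by
    intro t₀ ht₀ S' hS'
    rw [(hsolS S').remCost_eq t₀ (n := t - t₀ + N) (by omega), ← Finset.sum_sdiff hS',
      ← Finset.sum_sdiff (f := fun a => walkCost I a (fun s => τ.loc a (t₀ + s)) _) hS']
    refine add_lt_add_of_le_of_lt (Finset.sum_le_sum fun a ha => ?_) ?_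
    · rw [hwS' a (Finset.mem_sdiff.1 ha).2]
    · simp only [walkCost_add, Finset.sum_add_distrib]
      refine add_lt_add_of_le_of_lt (Finset.sum_le_sum fun a _ => ?_) ?_
      · exact (walkCost_congr fun s hs => hwle a _ (by omega)).le
      · refine lt_of_eq_of_lt (Finset.sum_congr rfl fun a ha => walkCost_congr fun s _ => ?_)
          (hlt.trans_eq (Finset.sum_congr rfl fun a _ => walkCost_congr fun s _ => ?_))
        · rw [hwge a ha _ (by omega)]
          congr 1
          omega
        · congr 1
          omega
  -- Regions do not depend on time, so the two walks avoid each other even at different times; this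
  -- excludes swaps too.
  have hregion : ∀ a ∈ S, ∀ b ∉ S, ∀ s s', t ≤ s → t ≤ s' → s ≤ t + N → s' ≤ t + N →
      w a s ≠ w b s' := by
    intro a ha b hb s s' hs hs' hsN hsN' e
    obtain ⟨t₀, ht₀, S', hSS', hbS', hdisj⟩ := hsep a ha b hb
    have hmem : ∀ b ∈ S', ∀ s, t ≤ s → s ≤ t + N → w b s ∈
        region I (fun a => τ.loc a t₀)
          (slackness I (fun a => τ.loc a t₀) S' (remCost I τ S' t₀)) b := by
      intro b hb s hs hsN
      have := mem_region (I := I) (p := fun a s => w a (t₀ + s)) (x := fun a => τ.loc a t₀)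
        (fun a _ => hwle a _ ht₀) (fun a _ s _ => hwm a _)
        (fun a _ => by
          rw [show t₀ + (t - t₀ + N) = t + N by omega]
          exact hwg a) (hcost t₀ ht₀ S' hSS') hb (s := s - t₀) (by omega)
      rwa [Nat.add_sub_cancel' (by omega)] at this
    exact Set.disjoint_left.1 hdisj (hmem a (hSS' ha) s hs hsN) (e ▸ hmem b hbS' s' hs' hsN')
  have hne : ∀ i j, i ≠ j → ∀ s ≤ t + N, w i s ≠ w j s := by
    intro i j hij s hsN
    by_cases hs : s ≤ t
    · rw [hwle i s hs, hwle j s hs]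
      exact hsol.loc_ne (hu i) (hu j) hij s
    · by_cases hi : i ∈ S <;> by_cases hj : j ∈ S
      · rw [hwge i hi s (by omega), hwge j hj s (by omega)]
        exact hc.loc_ne hi hj hij _
      · exact hregion i hi j hj s s (by omega) (by omega) hsN hsN
      · exact (hregion j hj i hi s s (by omega) (by omega) hsN hsN).symm
      · rw [hwS' i hi, hwS' j hj]
        exact hsol.loc_ne (hu i) (hu j) hij s
  have hswap : ∀ i j, i ≠ j → ∀ s, s + 1 ≤ t + N →
      ¬ (w i s = w j (s + 1) ∧ w i (s + 1) = w j s) := by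
    intro i j hij s hsN
    by_cases hs : s + 1 ≤ t
    · rw [hwle i s (by omega), hwle j s (by omega), hwle i _ hs, hwle j _ hs]
      exact hsol.loc_not_swap (hu i) (hu j) hij s
    · by_cases hi : i ∈ S <;> by_cases hj : j ∈ S
      · rw [hwge i hi s (by omega), hwge j hj s (by omega), hwge i hi _ (by omega),
          hwge j hj _ (by omega), Nat.sub_add_comm (by omega)]
        exact hc.loc_not_swap hi hj hij _
      · exact fun h => hregion i hi j hj s (s + 1) (by omega) (by omega) (by omega) hsN h.1
      · exact fun h => hregion j hj i hi s (s + 1) (by omega) (by omega) (by omega) hsN h.2.symm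
      · rw [hwS' i hi, hwS' j hj]
        exact hsol.loc_not_swap (hu i) (hu j) hij s
  have hnew : IsSolution I Finset.univ I.start ⟨t + N, w⟩ :=
    ⟨fun a _ => (hwle a 0 (Nat.zero_le _)).trans (hsol.loc_zero (hu a)), fun a _ s _ => hwm a s,
      fun a _ => hwg a, fun i _ j _ hij s =>
        ⟨fun h => hne i j hij s h.1 h.2, fun h => hswap i j hij s h.1 h.2⟩⟩
  refine (hopt _ hnew).not_gt ?_
  rw [soc_eq_sum_walkCost hwg, ← hsol.remCost_zero]
  -- For the whole fleet from time `0`, the saving contradicts the optimality of `τ`.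
  simpa using hcost 0 (Nat.zero_le _) Finset.univ (Finset.subset_univ _)

end Remainder

/-! ## The closed loop -/

section Lists

variable {α β : Type*} {R : α → β → Prop}

theorem exists_mem_of_forall₂ {l : List α} {l' : List β} (h : List.Forall₂ R l l') {b : β}
    (hb : b ∈ l') : ∃ a ∈ l, R a b := by
  induction h with
  | nil => simp at hb
  | cons hR _ ih =>
    rcases List.mem_cons.1 hb with rfl | hb
    · exact ⟨_, List.mem_cons_self, hR⟩
    · obtain ⟨a, ha, h⟩ := ih hb
      exact ⟨a, List.mem_cons_of_mem _ ha, h⟩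

theorem exists_forall₂ {l : List α} (h : ∀ a ∈ l, ∃ b, R a b) : ∃ l', List.Forall₂ R l l' := by
  induction l with
  | nil => exact ⟨[], .nil⟩
  | cons a l ih =>
    obtain ⟨b, hb⟩ := h a List.mem_cons_self
    obtain ⟨l', hl'⟩ := ih fun a ha => h a (List.mem_cons_of_mem _ ha)
    exact ⟨b :: l', .cons hb hl'⟩

theorem or_of_pairwise {r : α → α → Prop} {l : List α} (h : l.Pairwise r) {a b : α}
    (ha : a ∈ l) (hb : b ∈ l) (hab : a ≠ b) : r a b ∨ r b a := by
  induction h with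
  | nil => simp at ha
  | cons hr _ ih =>
    rcases List.mem_cons.1 ha with rfl | ha' <;> rcases List.mem_cons.1 hb with rfl | hb'
    · exact absurd rfl hab
    · exact .inl (hr _ hb')
    · exact .inr (hr _ ha')
    · exact ih ha' hb'

end Lists

section ClosedLoop

variable {A V : Type*} [DecidableEq V] {I : Instance A V} {π : BackupController I} {H t : ℕ}
  {T S₀ : ℕ∞} {x : A → V} {τ : JointTraj A V} {g : Group A V} {gs : List (Group A V)}

theorem Refactor.exists_mem (h : Refactor I T x g gs) {a : A} (ha : a ∈ g.agents) :
    ∃ k ∈ gs, a ∈ k.agents := by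
  rcases h with ⟨-, h⟩ | ⟨-, rfl⟩
  · exact (h.cover a).1 ha
  · exact ⟨g, List.mem_singleton_self g, ha⟩

theorem exists_refactor (I : Instance A V) (T : ℕ∞) (x : A → V) (g : Group A V) :
    ∃ gs, Refactor I T x g gs ∧ ∀ k ∈ gs, k.cert = g.cert := by
  by_cases h : T + slackness I x g.agents g.budget ≤ g.lastSlack
  · refine ⟨[⟨g.agents, g.cert, jointCost I g.agents g.cert.pos g.cert.len,
      slackness I x g.agents (jointCost I g.agents g.cert.pos g.cert.len)⟩], .inl ⟨h, ?_⟩, ?_⟩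
    · constructor <;> simp
    · simp
  · exact ⟨[g], .inr ⟨h, rfl⟩, by simp⟩

/-- Invariant of a group: it follows `τ`, its budget is the remaining cost, and it is separated
from all other agents. -/
structure GroupInv (I : Instance A V) (τ : JointTraj A V) (t : ℕ) (g : Group A V) : Prop where
  cert : g.cert = JointTraj.tail^[t] τ
  budget : g.budget = remCost I τ g.agents t
  separated : ∀ a ∈ g.agents, ∀ b ∉ g.agents, Separated I τ t g.agents a b

theorem GroupInv.inherit (hτ : IsSolution I g.agents x τ) (hg : GroupInv I τ t g) :
    GroupInv I τ (t + 1) (g.inherit I fun a => τ.loc a t) := by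
  refine ⟨?_, ?_, fun a ha b hb => ?_⟩
  · rw [Function.iterate_succ_apply', ← hg.cert, Group.inherit]
  · rw [Group.inherit, hg.budget, hτ.remCost_succ, ← Nat.cast_sum, ← ENat.natCast_sub,
      Nat.add_sub_cancel_left]
  · obtain ⟨t₀, ht₀, h⟩ := hg.separated a ha b hb
    exact ⟨t₀, ht₀.trans (Nat.le_succ t), h⟩

theorem GroupInv.refactor (hτ : IsSolution I g.agents x τ) (hg : GroupInv I τ t g)
    (h : Refactor I T (fun a => τ.loc a t) g gs) : ∀ k ∈ gs, GroupInv I τ t k := by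
  intro k hk
  rcases h with ⟨-, h⟩ | ⟨-, rfl⟩
  · have hsub : k.agents ⊆ g.agents := fun a ha => (h.cover a).2 ⟨k, hk, ha⟩
    refine ⟨(h.cert k hk).trans hg.cert, ?_, fun a ha b hb => ?_⟩
    · rw [h.budget k hk, hg.cert, (hτ.mono hsub).jointCost_tail_iterate]
    · by_cases hbg : b ∈ g.agents
      · obtain ⟨l, hl, hbl⟩ := (h.cover b).1 hbg
        have hkl : k ≠ l := fun e => hb (e ▸ hbl)
        -- Here `b` belongs to another part of the same group, so the separation happens now;
        -- otherwise it is inherited from an earlier factorization.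
        refine ⟨t, le_rfl, g.agents, hsub, hbg, ?_⟩
        rw [← hg.budget]
        rcases or_of_pairwise h.separated hk hl hkl with h | h
        · exact h a ha b hbl
        · exact (h b hbl a ha).symm
      · obtain ⟨t₀, ht₀, S, hS, hbS, h⟩ := hg.separated a (hsub ha) b hbg
        exact ⟨t₀, ht₀, S, hsub.trans hS, hbS, h⟩
  · rwa [List.mem_singleton.1 hk]

/-- Invariant of the closed loop after the first control step. -/
structure SystemInv (I : Instance A V) (τ : JointTraj A V) (t : ℕ) (σ : SystemState A V) :
    Prop where
  pos : σ.pos = fun a => τ.loc a t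
  cover : ∀ a, ∃ g ∈ σ.groups, a ∈ g.agents
  groupInv : ∀ g ∈ σ.groups, GroupInv I τ t g

section

variable [DecidableEq A] {σ : SystemState A V}

/-- The common certificate `c` makes the next positions prescribed by the groups consistent. -/
theorem exists_controlStep {c : JointTraj A V} (hσ : ¬ σ.Terminal I)
    (h : ∀ g ∈ σ.groups, ∃ gs, GroupPlan I π H T σ.pos g gs ∧ ∀ k ∈ gs, k.cert = c) :
    ∃ σ', ControlStep I π H T σ σ' := by
  obtain ⟨gss, hgss⟩ := exists_forall₂ h
  refine ⟨⟨fun a => c.loc a 1, gss.flatten.map (Group.inherit I σ.pos)⟩, hσ, gss,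
    hgss.imp fun _ _ h => h.1, fun k hk a _ => ?_, rfl⟩
  obtain ⟨gs, hgs, hk⟩ := List.mem_flatten.1 hk
  obtain ⟨g, -, hp⟩ := exists_mem_of_forall₂ hgss hgs
  rw [hp.2 k hk]

end

variable [Fintype A] {σ σ' : SystemState A V}

theorem systemInv_succ (hτ : IsSolution I Finset.univ x τ) (hpos : σ.pos = fun a => τ.loc a t)
    {ks : List (Group A V)} (hcover : ∀ a, ∃ k ∈ ks, a ∈ k.agents)
    (hks : ∀ k ∈ ks, GroupInv I τ t k)
    (hpos' : ∀ k ∈ ks, ∀ a ∈ k.agents, σ'.pos a = k.cert.loc a 1)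
    (hgroups : σ'.groups = ks.map (Group.inherit I σ.pos)) : SystemInv I τ (t + 1) σ' := by
  refine ⟨funext fun a => ?_, fun a => ?_, fun g hg => ?_⟩
  · obtain ⟨k, hk, ha⟩ := hcover a
    rw [hpos' k hk a ha, (hks k hk).cert, JointTraj.loc_tail_iterate]
  · obtain ⟨k, hk, ha⟩ := hcover a
    exact ⟨k.inherit I σ.pos, hgroups ▸ List.mem_map_of_mem hk, ha⟩
  · rw [hgroups, List.mem_map] at hg
    obtain ⟨k, hk, rfl⟩ := hg
    rw [hpos]
    exact (hks k hk).inherit (hτ.mono (Finset.subset_univ _))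

theorem SystemStart.exists_groups (hsol : ∃ τ, IsSolution I Finset.univ I.start τ)
    (hσ : SystemStart I π S₀ σ) : ∃ c, IsSolution I Finset.univ I.start c ∧
      σ.groups = [⟨Finset.univ, c, jointCost I Finset.univ c.pos c.len, S₀⟩] := by
  obtain ⟨τ, hτ⟩ := hsol
  obtain ⟨-, c, hc, hg⟩ := hσ
  refine ⟨c, rollout_isSolution (fun i hi j hj hij e => hτ.loc_ne hi hj hij 0 ?_) hc, hg⟩
  rw [hτ.loc_zero hi, hτ.loc_zero hj, e]

theorem exists_systemStart (hsol : ∃ τ, IsSolution I Finset.univ I.start τ)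
    (π : BackupController I) (S₀ : ℕ∞) : ∃ σ, SystemStart I π S₀ σ := by
  obtain ⟨c, hc⟩ : ∃ c, rollout π Finset.univ I.start = some c := by
    unfold rollout
    split
    · exact ⟨_, rfl⟩
    · exact π.complete _ _ hsol
  exact ⟨⟨I.start, _⟩, rfl, c, hc, rfl⟩

/-- Padding with waits at the goals brings the length to exactly `H`; this is where the makespan
bound enters. -/
theorem IsSOCOptimal.isJointWalk (hτ : IsSOCOptimal I τ) (hlen : τ.len ≤ H) :
    IsJointWalk I Finset.univ H I.start τ.loc :=
  ⟨fun _ => hτ.1.loc_zero, fun _ ha t _ => hτ.1.loc_adj ha t, fun _ ha => hτ.1.loc_goal ha hlen,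
    hτ.1.conflictFree_loc H⟩

variable [DecidableEq A]

/-- By `IsSOCOptimal.remCost_le` no solution undercuts the budget, so the search leaves certificate
and budget alone and only the factorization acts. -/
theorem GroupInv.refactor_of_groupPlan (hH : 1 ≤ H) (hτ : IsSOCOptimal I τ)
    (hg : GroupInv I τ t g) (h : GroupPlan I π H T (fun a => τ.loc a t) g gs) :
    Refactor I T (fun a => τ.loc a t) g gs := by
  obtain ⟨s₀, s, h0, hs, -, hr⟩ := h
  obtain ⟨hc, hb⟩ := search_cert_eq hH
    (fun c hc => hg.budget ▸ hτ.remCost_le hg.separated hc) h0 hs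
  rwa [hc, hb] at hr

theorem SystemInv.controlStep (hH : 1 ≤ H) (hτ : IsSOCOptimal I τ) (hσ : SystemInv I τ t σ)
    (h : ControlStep I π H T σ σ') : SystemInv I τ (t + 1) σ' := by
  obtain ⟨-, gss, hplan, hpos', hgroups⟩ := h
  rw [hσ.pos] at hplan
  refine systemInv_succ hτ.1 hσ.pos (fun a => ?_) (fun k hk => ?_) hpos' hgroups
  · obtain ⟨g, hg, ha⟩ := hσ.cover a
    obtain ⟨gs, hgs, hp⟩ := exists_mem_of_forall₂ hplan.flip hg
    obtain ⟨k, hk, hak⟩ :=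
      ((hσ.groupInv g hg).refactor_of_groupPlan hH hτ hp).exists_mem ha
    exact ⟨k, List.mem_flatten.2 ⟨gs, hgs, hk⟩, hak⟩
  · obtain ⟨gs, hgs, hk⟩ := List.mem_flatten.1 hk
    obtain ⟨g, hg, hp⟩ := exists_mem_of_forall₂ hplan hgs
    exact (hσ.groupInv g hg).refactor (hτ.1.mono (Finset.subset_univ _))
      ((hσ.groupInv g hg).refactor_of_groupPlan hH hτ hp) k hk

theorem exists_groupPlan [Finite V] (hH : 1 ≤ H) (π : BackupController I) (T : ℕ∞) (x : A → V)
    (g : Group A V) : ∃ gs c, GroupPlan I π H T x g gs ∧ ∀ k ∈ gs, k.cert = c := by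
  obtain ⟨s₀, s, h0, hs, hhalt⟩ := (search_terminates (I := I) (π := π) (S := g.agents) (x := x)
    hH g.cert g.budget).exists_final
  obtain ⟨gs, hgs, hc⟩ := exists_refactor I T x { g with cert := s.cert, budget := s.budget }
  exact ⟨gs, _, ⟨s₀, s, h0, hs, hhalt, hgs⟩, hc⟩

theorem SystemInv.exists_controlStep [Finite V] (hH : 1 ≤ H) (π : BackupController I) (T : ℕ∞)
    (hτ : IsSOCOptimal I τ) (hσ : SystemInv I τ t σ) (hfin : ¬ σ.Terminal I) :
    ∃ σ', ControlStep I π H T σ σ' := by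
  refine MAPF.exists_controlStep (c := JointTraj.tail^[t] τ) hfin fun g hg => ?_
  obtain ⟨gs, -, hp, -⟩ := exists_groupPlan hH π T σ.pos g
  refine ⟨gs, hp, fun k hk => ?_⟩
  rw [hσ.pos] at hp
  exact ((hσ.groupInv g hg).refactor (hτ.1.mono (Finset.subset_univ _))
      ((hσ.groupInv g hg).refactor_of_groupPlan hH hτ hp) k hk).cert

/-! ## The first control step -/

theorem initial_search (hH : 1 ≤ H) (hτ : IsSOCOptimal I τ) (hlen : τ.len ≤ H)
    {c : JointTraj A V} (hc : IsSolution I Finset.univ I.start c) {s₀ s : SearchState A V}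
    (h0 : SearchStart I Finset.univ H I.start c (jointCost I Finset.univ c.pos c.len) s₀)
    (h : Relation.ReflTransGen (SearchStep I π Finset.univ H I.start) s₀ s) (hs : s.Halted) :
    ∃ n, s.phase = .found n ∧ s.horizon = H ∧ IsSOCOptimal I ⟨H, n.traj⟩ ∧
      IsSOCOptimal I s.cert ∧ s.budget = (soc I s.cert : ℕ∞) := by
  have hq := hτ.isJointWalk hlen
  obtain ⟨n, hn, hh, hsol, hle, hb⟩ := search_found hH hq h0 h hs
  obtain ⟨hcert, hbudget⟩ := search_cert_isSolution hH hc h0 h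
  rw [hcert.jointCost_eq_soc] at hbudget
  have hcost : jointCost I Finset.univ τ.loc H = (soc I τ : ℕ∞) := by
    rw [jointCost_of_goal hq.target, ← hτ.1.jointCost_eq hlen, hτ.1.jointCost_eq_soc]
  have hn' : n.cost I Finset.univ H = (soc I ⟨H, n.traj⟩ : ℕ∞) := hsol.jointCost_eq_soc
  rw [hcost, hn', Nat.cast_le] at hle
  rw [hbudget, hn', Nat.cast_le] at hb
  -- The chain is: cost of the certificate, at most that of the node, at most that of `τ`.
  exact ⟨n, hn, hh, ⟨hsol, fun σ hσ => hle.trans (hτ.2 σ hσ)⟩,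
    ⟨hcert, fun σ hσ => (hb.trans hle).trans (hτ.2 σ hσ)⟩, hbudget⟩

/-- The optimal solution followed from now on is the certificate of the first search; it depends on
the choices made there and may differ from `τ`. -/
theorem SystemStart.controlStep (hH : 1 ≤ H) (hτ : IsSOCOptimal I τ) (hlen : τ.len ≤ H)
    (hσ : SystemStart I π S₀ σ) (h : ControlStep I π H T σ σ') :
    ∃ τ', IsSOCOptimal I τ' ∧ SystemInv I τ' 1 σ' := by
  obtain ⟨c, hc, hg⟩ := hσ.exists_groups ⟨τ, hτ.1⟩
  obtain ⟨-, gss, hplan, hpos', hgroups⟩ := h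
  rw [hg, hσ.1] at hplan
  obtain ⟨gs, rest, ⟨s₀, s, h0, hs, hhalt, hr⟩, hrest, rfl⟩ := List.forall₂_cons_left_iff.1 hplan
  obtain rfl := List.forall₂_nil_left_iff.1 hrest
  obtain ⟨-, -, -, -, hopt, hb⟩ := initial_search hH hτ hlen hc h0 hs hhalt
  have hx : I.start = fun a => s.cert.loc a 0 :=
    funext fun a => (hopt.1.loc_zero (Finset.mem_univ a)).symm
  -- No agent lies outside the initial group, so separation is vacuous.
  have hinv : GroupInv I s.cert 0 ⟨Finset.univ, s.cert, s.budget, S₀⟩ :=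
    ⟨rfl, by rw [hb, hopt.1.remCost_zero], fun _ _ b hb => absurd (Finset.mem_univ b) hb⟩
  refine ⟨s.cert, hopt, systemInv_succ (t := 0) hopt.1 (hσ.1.trans hx) (fun a => ?_) ?_ hpos'
    hgroups⟩
  · simpa using hr.exists_mem (Finset.mem_univ a)
  · simpa using hinv.refactor hopt.1 (hx ▸ hr)

theorem SystemStart.exists_controlStep [Finite V] (hH : 1 ≤ H)
    (hsol : ∃ τ, IsSolution I Finset.univ I.start τ) (hσ : SystemStart I π S₀ σ) (T : ℕ∞)
    (hfin : ¬ σ.Terminal I) : ∃ σ', ControlStep I π H T σ σ' := by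
  obtain ⟨c, -, hg⟩ := hσ.exists_groups hsol
  obtain ⟨gs, c', h⟩ := exists_groupPlan hH π T σ.pos
    ⟨Finset.univ, c, jointCost I Finset.univ c.pos c.len, S₀⟩
  exact MAPF.exists_controlStep (c := c') hfin fun g hg' => by
    rw [hg, List.mem_singleton] at hg'
    exact ⟨gs, hg' ▸ h⟩

/-! ## Runs of the closed loop -/

theorem systemInv_of_reachable (hH : 1 ≤ H) (hτ : IsSOCOptimal I τ) (hlen : τ.len ≤ H)
    {σ₀ : SystemState A V} (h0 : SystemStart I π S₀ σ₀)
    (h : Relation.ReflTransGen (ControlStep I π H T) σ₀ σ) :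
    SystemStart I π S₀ σ ∨ ∃ τ' t, IsSOCOptimal I τ' ∧ SystemInv I τ' t σ := by
  induction h with
  | refl => exact .inl h0
  | tail _ hst ih =>
    rcases ih with ih | ⟨τ', t, hτ', hinv⟩
    · obtain ⟨τ', hτ', hinv⟩ := ih.controlStep hH hτ hlen hst
      exact .inr ⟨τ', 1, hτ', hinv⟩
    · exact .inr ⟨τ', t + 1, hτ', hinv.controlStep hH hτ' hst⟩

/-- Every run of the closed loop follows an optimal joint trajectory. -/
theorem exists_optimal_of_run (hH : 1 ≤ H) (hτ : IsSOCOptimal I τ) (hlen : τ.len ≤ H) {k : ℕ}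
    {f : ℕ → SystemState A V} (h0 : SystemStart I π S₀ (f 0))
    (hf : ∀ i < k, ControlStep I π H T (f i) (f (i + 1))) :
    ∃ τ', IsSOCOptimal I τ' ∧ ∀ i ≤ k, ∀ a, (f i).pos a = τ'.loc a i := by
  have hzero : ∀ τ', IsSOCOptimal I τ' → ∀ a, (f 0).pos a = τ'.loc a 0 := fun τ' hτ' a => by
    rw [h0.1, hτ'.1.loc_zero (Finset.mem_univ a)]
  rcases Nat.eq_zero_or_pos k with rfl | hk
  · exact ⟨τ, hτ, fun i hi => by rw [Nat.le_zero.1 hi]; exact hzero τ hτ⟩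
  · obtain ⟨τ', hτ', h1⟩ := h0.controlStep hH hτ hlen (hf 0 hk)
    have hinv : ∀ i < k, SystemInv I τ' (i + 1) (f (i + 1)) := by
      intro i hi
      induction i with
      | zero => exact h1
      | succ i ih => exact (ih (by omega)).controlStep hH hτ' (hf _ hi)
    refine ⟨τ', hτ', fun i hi a => ?_⟩
    rcases i with _ | i
    · exact hzero τ' hτ' a
    · rw [(hinv i (by omega)).pos]

/-- Some agent is away from its goal before each step, so each step uses up at least one unit of the
optimal cost. -/
theorem run_length_le (hH : 1 ≤ H) (hτ : IsSOCOptimal I τ) (hlen : τ.len ≤ H) {k : ℕ}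
    {f : ℕ → SystemState A V} (h0 : SystemStart I π S₀ (f 0))
    (hf : ∀ i < k, ControlStep I π H T (f i) (f (i + 1))) : k ≤ soc I τ := by
  obtain ⟨τ', hτ', hpos⟩ := exists_optimal_of_run hH hτ hlen h0 hf
  have hpay : ∀ i < k, 1 ≤ ∑ a, runningCost I a (τ'.loc a i) := by
    intro i hi
    obtain ⟨a, ha⟩ := not_forall.1 (hf i hi).1
    refine le_trans ?_ (Finset.single_le_sum (fun _ _ => Nat.zero_le _) (Finset.mem_univ a))
    rw [runningCost, if_neg (hpos i hi.le a ▸ ha)]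
  have hsum : ∀ i ≤ k, i + remCost I τ' Finset.univ i ≤ soc I τ' := by
    intro i hi
    induction i with
    | zero => rw [hτ'.1.remCost_zero, zero_add]
    | succ i ih =>
      have := ih (by omega)
      have := hpay i (by omega)
      have := hτ'.1.remCost_succ i
      omega
  have := hsum k le_rfl
  have := hτ'.2 τ hτ.1
  omega

/-- The executed trajectory is a prefix of an optimal one, so it is conflict-free and costs no more.
-/
theorem isSOCOptimal_of_run (hH : 1 ≤ H) (hτ : IsSOCOptimal I τ) (hlen : τ.len ≤ H) {k : ℕ}
    {f : ℕ → SystemState A V} (h0 : SystemStart I π S₀ (f 0))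
    (hf : ∀ i < k, ControlStep I π H T (f i) (f (i + 1))) (hk : (f k).Terminal I) :
    IsSOCOptimal I ⟨k, fun a t => (f t).pos a⟩ := by
  obtain ⟨τ', hτ', hpos⟩ := exists_optimal_of_run hH hτ hlen h0 hf
  have hu : ∀ a : A, a ∈ Finset.univ := Finset.mem_univ
  -- At time `τ'.len` all agents are at their goals, and no control step leaves a terminal state.
  have hkl : k ≤ τ'.len := by
    by_contra! hlt
    exact (hf _ hlt).1 fun a => (hpos _ hlt.le a).trans (hτ'.1.loc_goal (hu a) le_rfl)
  have hloc : ∀ a t, t ≤ k → (JointTraj.mk k fun a t => (f t).pos a).loc a t = τ'.loc a t :=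
    fun a t ht => by rw [JointTraj.loc_of_le ht, ← hpos t ht a]
  refine ⟨⟨fun a _ => congrFun h0.1 a, fun a _ t ht => ?_, fun a _ => hk a,
    fun i hi j hj hij t => ⟨fun h => ?_, fun h => ?_⟩⟩, fun ρ hρ => le_trans ?_ (hτ'.2 ρ hρ)⟩
  · dsimp only at ht ⊢
    rw [hpos t ht.le, hpos _ ht]
    exact hτ'.1.loc_adj (hu a) t
  · obtain ⟨h1, h2⟩ := h
    dsimp only at h1 h2
    rw [hpos t h1, hpos t h1] at h2
    exact hτ'.1.loc_ne hi hj hij t h2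
  · obtain ⟨h1, h2⟩ := h
    dsimp only at h1 h2
    rw [hpos t (by omega), hpos _ h1, hpos t (by omega), hpos _ h1] at h2
    exact hτ'.1.loc_not_swap hi hj hij t h2
  · rw [soc_eq_sum_walkCost (by exact hk), soc_eq_sum_walkCost fun a => hτ'.1.target a (hu a)]
    refine Finset.sum_le_sum fun a _ => ?_
    dsimp only
    rw [walkCost_congr (q := τ'.pos a) fun t ht => by
      rw [hpos t ht.le, JointTraj.loc_of_le (by omega)]]
    exact Finset.sum_le_sum_of_subset (Finset.range_mono hkl)

end ClosedLoop

end MAPF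

theorem mainTheorem5 {A V : Type*} [Fintype A] [DecidableEq A] [Fintype V] [DecidableEq V]
    (I : MAPF.Instance A V) (π : MAPF.BackupController I)
    (Hmax : ℕ) (hH : 1 ≤ Hmax) (T S₀ : ℕ∞)
    (hopt : ∃ τ, MAPF.IsSOCOptimal I τ ∧ τ.len ≤ Hmax) :
    -- the planning call at the start: it terminates, and every complete run returns an optimal
    -- joint trajectory of length `Hmax` and an optimal certificate
    (∀ σ, MAPF.SystemStart I π S₀ σ → ∀ g ∈ σ.groups,
      MAPF.Terminates
        (MAPF.SearchStart I g.agents Hmax σ.pos g.cert g.budget)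
        (MAPF.SearchStep I π g.agents Hmax σ.pos) MAPF.SearchState.Halted ∧
      ∀ s₀ s, MAPF.SearchStart I g.agents Hmax σ.pos g.cert g.budget s₀ →
        Relation.ReflTransGen (MAPF.SearchStep I π g.agents Hmax σ.pos) s₀ s → s.Halted →
        ∃ n, s.phase = .found n ∧ s.horizon = Hmax ∧
          MAPF.IsSOCOptimal I ⟨Hmax, n.traj⟩ ∧
          MAPF.IsSOCOptimal I s.cert ∧ s.budget = (MAPF.soc I s.cert : ℕ∞)) ∧
    -- the planning calls of all later control steps terminate
    (∀ σ₀ σ, MAPF.SystemStart I π S₀ σ₀ →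
      Relation.ReflTransGen (MAPF.ControlStep I π Hmax T) σ₀ σ → ∀ g ∈ σ.groups,
      MAPF.Terminates
        (MAPF.SearchStart I g.agents Hmax σ.pos g.cert g.budget)
        (MAPF.SearchStep I π g.agents Hmax σ.pos) MAPF.SearchState.Halted) ∧
    -- the closed loop terminates, and what it executes is optimal
    MAPF.Terminates (MAPF.SystemStart I π S₀) (MAPF.ControlStep I π Hmax T)
      (MAPF.SystemState.Terminal I) ∧
    (∀ (k : ℕ) (f : ℕ → MAPF.SystemState A V), MAPF.SystemStart I π S₀ (f 0) →
      (∀ i < k, MAPF.ControlStep I π Hmax T (f i) (f (i + 1))) → (f k).Terminal I →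
      MAPF.IsSOCOptimal I ⟨k, fun a t => (f t).pos a⟩) := by
  obtain ⟨τ, hτ, hlen⟩ := hopt
  refine ⟨fun σ hσ g hg => ⟨MAPF.search_terminates hH _ _, fun s₀ s h0 hs hhalt => ?_⟩,
    fun _ σ _ _ g _ => MAPF.search_terminates hH _ _,
    ⟨MAPF.exists_systemStart ⟨τ, hτ.1⟩ π S₀,
      ⟨MAPF.soc I τ, fun k f h0 hf => MAPF.run_length_le hH hτ hlen h0 hf⟩,
      fun σ₀ σ h0 h hfin => ?_⟩,
    fun k f h0 hf hk => MAPF.isSOCOptimal_of_run hH hτ hlen h0 hf hk⟩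
  · obtain ⟨c, hc, hgroups⟩ := hσ.exists_groups ⟨τ, hτ.1⟩
    rw [hgroups, List.mem_singleton] at hg
    subst hg
    rw [hσ.1] at h0 hs
    exact MAPF.initial_search hH hτ hlen hc h0 hs hhalt
  · rcases MAPF.systemInv_of_reachable hH hτ hlen h0 h with hσ | ⟨τ', t, hτ', hσ⟩
    · exact hσ.exists_controlStep hH ⟨τ, hτ.1⟩ T hfin
    · exact hσ.exists_controlStep hH π T hτ' hfin
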